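/- **Definitions.** A polymatroid $(E,f)$ is a set $E$, possibly infinite, with a function $f:\mathcal P(E)\to\mathbb R$ such that $f(\emptyset)=0$, $f(A)\le f(B)$ whenever $A\subseteq B\subseteq E$, and $f(A)+f(B)\ge f(A\cup B)+f(A\cap B)$ for all $A,B\subseteq E$. It is of finite type if $f(S)=\sup\{f(F)\mid F\subseteq S \text{ finite}\}$ for every $S\subseteq E$ (this is automatic for finite $E$). We write $f(p,q,\dots)$ for $f(\{p,q,\dots\})$. A polymatroid $h$ on $E$ is entropic if there are a finite probability space and random variables $(X_i)_{i\in E}$ on it such that $h(S)$ is the Shannon entropy (to base $2$) of $(X_i)_{i\in S}$ for every $S\subseteq E$. A polymatroid $f$ on $E$ is almost entropic if it is of finite type and lies in the closure of the set of entropic polymatroids on $E$ in the topology of pointwise convergence on $\mathbb R^{\mathcal P(E)}$; for countable $E$ this means that $f$ is of finite type and is the pointwise limit of a sequence of entropic polymatroids on $E$. An extension of $(E,f)$ is a polymatroid $(\hat E,\hat f)$ with $E\subseteq\hat E$ and $\hat f(S)=f(S)$ for all $S\subseteq E$. **Theorem.** Let $(E,f)$ be an almost entropic polymatroid, let $O,a_1,a_2,a_3,b_1,b_2,b_3,x_1,x_2$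 be nine distinct elements of $E$, and let $C$ be the set of these nine elements. Assume $$\begin{cases} f(p)=1 \text{ for each } p\in C,\\ f(p,q)=2 \text{ for distinct } p,q\in C,\\ f(O,a_i,b_i)=2 \text{ for } i=1,2,3,\\ f(a_2,a_3,x_1)=2=f(b_2,b_3,x_1),\\ f(a_1,a_3,x_2)=2=f(b_1,b_3,x_2),\\ f(O,a_1,a_2,a_3)=4.\end{cases}$$ Then there exist an almost entropic extension $(\hat E,\hat f)$ of $(E,f)$ and an element $x_3\in\hat E$ such that $$\begin{cases}\hat f(x_3)=1,\\ \hat f(a_1,a_2,x_3)=2=\hat f(b_1,b_2,x_3),\\ \hat f(a_1,x_3)=2=\hat f(b_1,x_3),\\ \hat f(x_1,x_2,x_3)=2,\end{cases}$$ and such that, moreover, every $\tilde x_3\in E$ with $f(a_1,a_2,\tilde x_3)=2=f(b_1,b_2,\tilde x_3)$, $f(\tilde x_3)=1$ and $f(\tilde x_3,a_1)=2=f(\tilde x_3,b_1)$ satisfies $\hat f(x_3,\tilde x_3)=1$ and $f(x_1,x_2,\tilde x_3)=2$. -/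

import Mathlib

open Set Filter Topology

universe u

/-- A polymatroid on the ground set `E` (a type): a normalized, monotone, submodular function on
the subsets of `E`. The ground set may be infinite. -/
structure IsPolymatroid {E : Type*} (f : Set E → ℝ) : Prop where
  empty : f ∅ = 0
  mono : ∀ A B : Set E, A ⊆ B → f A ≤ f B
  submodular : ∀ A B : Set E, f (A ∪ B) + f (A ∩ B) ≤ f A + f B

/-- Finite type: `f S = sup {f F | F ⊆ S finite}` for all `S`. For a polymatroid on a finite ground
set this holds automatically. -/
def IsFiniteType {E : Type*} (f : Set E → ℝ) : Prop :=
  ∀ S : Set E, IsLUB {r : ℝ | ∃ F : Set E, F ⊆ S ∧ F.Finite ∧ r = f F} (f S)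

/-- `P (X = x)` for a random variable `X` on the finite probability space `(Ω, P)`. -/
noncomputable def probEq {Ω : Type*} [Fintype Ω] (P : Ω → ℝ) {V : Type*} (X : Ω → V) (x : V) : ℝ :=
  ∑ ω : Ω, {ω' : Ω | X ω' = x}.indicator P ω

/-- Shannon entropy (in bits) of a random variable `X` on the finite probability space `(Ω, P)`.
Only finitely many values `x` have positive probability, so the support of the sum is finite,
and a term with `P (X = x) = 0` is `0`. -/
noncomputable def entropy {Ω : Type*} [Fintype Ω] (P : Ω → ℝ) {V : Type*} (X : Ω → V) : ℝ :=
  ∑ᶠ x : V, probEq P X x * Real.logb 2 (1 / probEq P X x)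

/-- `h` is entropic: there are random variables `(X i)`, `i : E`, on a finite probability space
such that `h S` is the entropy of the tuple `X_S = (X i)_{i ∈ S}`. -/
def IsEntropic {E : Type*} (h : Set E → ℝ) : Prop :=
  ∃ (Ω : Type) (_ : Fintype Ω) (P : Ω → ℝ) (V : E → Type) (X : ∀ i : E, Ω → V i),
    P ∈ stdSimplex ℝ Ω ∧ ∀ S : Set E, h S = entropy P (fun ω (i : S) => X i ω)

/-- An almost entropic polymatroid: a polymatroid of finite type that lies in the closure of the
set of entropic polymatroids for the topology of pointwise convergence on `Set E → ℝ`.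
For countable `E` this says that it is the pointwise limit of a sequence of entropic polymatroids,
see `isAlmostEntropic_iff_seq`. -/
structure IsAlmostEntropic {E : Type*} (f : Set E → ℝ) : Prop where
  polymatroid : IsPolymatroid f
  finiteType : IsFiniteType f
  mem_closure : f ∈ closure {h : Set E → ℝ | IsEntropic h}

/-- On every ground set, a finite type polymatroid which is the pointwise limit of a sequence of
entropic polymatroids is almost entropic. -/
theorem isAlmostEntropic_of_seq {E : Type*} {f : Set E → ℝ} (hf : IsPolymatroid f)
    (hf' : IsFiniteType f) (h : ℕ → Set E → ℝ) (hh : ∀ n, IsEntropic (h n))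
    (hlim : ∀ S : Set E, Tendsto (fun n => h n S) atTop (𝓝 (f S))) : IsAlmostEntropic f :=
  ⟨hf, hf', mem_closure_of_tendsto (tendsto_pi_nhds.2 hlim) (Eventually.of_forall hh)⟩

theorem entropy_eq_sum {Ω : Type*} [Fintype Ω] (P : Ω → ℝ) {V : Type*} (X : Ω → V) :
    entropy P X = ∑ ω : Ω, P ω * Real.logb 2 (1 / probEq P X (X ω)) := by
  classical
  have hsupp : Function.support (fun x : V => probEq P X x * Real.logb 2 (1 / probEq P X x)) ⊆
      ((Finset.univ.image X : Finset V) : Set V) := by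
    intro x hx
    by_contra hxn
    apply hx
    have : probEq P X x = 0 := by
      refine Finset.sum_eq_zero fun ω _ => ?_
      refine Set.indicator_of_notMem ?_ _
      intro hω
      exact hxn (by simpa using ⟨ω, hω⟩)
    simp [this]
  rw [entropy, finsum_eq_sum_of_support_subset _ hsupp,
    ← Finset.sum_fiberwise_of_maps_to (s := Finset.univ) (t := Finset.univ.image X) (g := X)
      (fun ω _ => Finset.mem_image_of_mem X (Finset.mem_univ ω))]
  refine Finset.sum_congr rfl fun x _ => ?_
  have h1 : ∑ ω ∈ Finset.univ with X ω = x, P ω * Real.logb 2 (1 / probEq P X (X ω)) =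
      ∑ ω ∈ Finset.univ with X ω = x, P ω * Real.logb 2 (1 / probEq P X x) := by
    refine Finset.sum_congr rfl fun ω hω => ?_
    rw [(Finset.mem_filter.1 hω).2]
  rw [h1, ← Finset.sum_mul]
  congr 1
  simp [probEq, Set.indicator_apply, Finset.sum_filter]

theorem entropy_congr {Ω : Type*} [Fintype Ω] (P : Ω → ℝ) {V W : Type*} (X : Ω → V) (Y : Ω → W)
    (h : ∀ ω ω', X ω = X ω' ↔ Y ω = Y ω') : entropy P X = entropy P Y := by
  rw [entropy_eq_sum, entropy_eq_sum]
  refine Finset.sum_congr rfl fun ω _ => ?_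
  have : probEq P X (X ω) = probEq P Y (Y ω) := by
    have hs : {ω' : Ω | X ω' = X ω} = {ω' : Ω | Y ω' = Y ω} := by
      ext ω'
      exact h ω' ω
    simp only [probEq, hs]
  rw [this]

theorem IsEntropic.inter {E : Type*} {h : Set E → ℝ} (hh : IsEntropic h) (A : Set E) :
    IsEntropic (fun S => h (S ∩ A)) := by
  classical
  obtain ⟨Ω, _, P, V, X, hP, hX⟩ := hh
  have hne : Nonempty Ω := by
    by_contra hcon
    rw [not_nonempty_iff] at hcon
    have := hP.2
    simp at this
  obtain ⟨ω₀⟩ := hne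
  refine ⟨Ω, inferInstance, P, V, fun i ω => if i ∈ A then X i ω else X i ω₀, hP, fun S => ?_⟩
  simp only [hX]
  refine entropy_congr P _ _ fun ω ω' => ?_
  simp only [funext_iff, Subtype.forall]
  constructor
  · intro H i hi
    by_cases hA : i ∈ A
    · simpa [hA] using H i ⟨hi, hA⟩
    · simp [hA]
  · intro H i hi
    simpa [hi.2] using H i hi.1

/-- On a countable ground set, almost entropic polymatroids are exactly the finite type
polymatroids that are pointwise limits of sequences of entropic polymatroids. -/
theorem isAlmostEntropic_iff_seq {E : Type*} [Countable E] (f : Set E → ℝ) :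
    IsAlmostEntropic f ↔ IsPolymatroid f ∧ IsFiniteType f ∧
      ∃ h : ℕ → Set E → ℝ, (∀ n, IsEntropic (h n)) ∧
        ∀ S : Set E, Tendsto (fun n => h n S) atTop (𝓝 (f S)) := by
  refine ⟨fun H => ⟨H.polymatroid, H.finiteType, ?_⟩,
    fun ⟨h1, h2, h, h3, h4⟩ => isAlmostEntropic_of_seq h1 h2 h h3 h4⟩
  obtain ⟨e, he⟩ := exists_injective_nat E
  set A : ℕ → Set E := fun n => {i | e i < n} with hA
  have hAfin : ∀ n, (A n).Finite := fun n => (Set.finite_lt_nat n).preimage he.injOn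
  have happrox : ∀ n : ℕ, ∃ h : Set E → ℝ, IsEntropic h ∧
      ∀ S ⊆ A n, |h S - f S| < 1 / ((n : ℝ) + 1) := by
    intro n
    have hpos : (0 : ℝ) < 1 / ((n : ℝ) + 1) := by positivity
    have hopen : {g : Set E → ℝ | ∀ S ∈ 𝒫 (A n), |g S - f S| < 1 / ((n : ℝ) + 1)} ∈ 𝓝 f := by
      simp only [Set.ofPred_forall]
      refine (Filter.biInter_mem (hAfin n).finite_subsets).2 fun S _ => ?_
      have hc : Continuous fun g : Set E → ℝ => |g S - f S| :=
        ((continuous_apply S).sub continuous_const).abs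
      exact hc.continuousAt.eventually_lt continuousAt_const (by simpa using hpos)
    obtain ⟨g, hg, hg'⟩ := mem_closure_iff_nhds.1 H.mem_closure _ hopen
    exact ⟨g, hg', fun S hS => hg S hS⟩
  choose h hh happ using happrox
  refine ⟨fun n S => h n (S ∩ A n), fun n => (hh n).inter (A n), fun S => ?_⟩
  have h1 : Tendsto (fun n => f (S ∩ A n)) atTop (𝓝 (f S)) := by
    refine tendsto_order.2 ⟨fun c hc => ?_, fun c hc => Eventually.of_forall fun n =>
      lt_of_le_of_lt (H.polymatroid.mono _ _ Set.inter_subset_left) hc⟩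
    obtain ⟨_, ⟨F, hFS, hF, rfl⟩, hcF, -⟩ := (H.finiteType S).exists_between hc
    obtain ⟨N, hN⟩ := (hF.image e).bddAbove
    filter_upwards [eventually_gt_atTop N] with n hn
    refine lt_of_lt_of_le hcF (H.polymatroid.mono _ _ fun i hi => ⟨hFS hi, ?_⟩)
    exact lt_of_le_of_lt (hN (Set.mem_image_of_mem e hi)) hn
  have h2 : Tendsto (fun n => h n (S ∩ A n) - f (S ∩ A n)) atTop (𝓝 0) :=
    squeeze_zero_norm (fun n => (happ n _ Set.inter_subset_right).le)
      tendsto_one_div_add_atTop_nhds_zero_nat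
  simpa using h2.add h1

/-- A rank 4 Desargues configuration: nine distinct points, each of rank 1 and each two of rank 2,
such that the triples `a` and `b` are in perspective from `O`, with `x₁` on the lines `a₂a₃` and
`b₂b₃`, with `x₂` on the lines `a₁a₃` and `b₁b₃`, and with `O, a₁, a₂, a₃` of rank 4. -/
structure IsDesarguesConfiguration {E : Type*} (f : Set E → ℝ)
    (O a₁ a₂ a₃ b₁ b₂ b₃ x₁ x₂ : E) : Prop where
  distinct : [O, a₁, a₂, a₃, b₁, b₂, b₃, x₁, x₂].Nodup
  rank_point : ∀ p ∈ ({O, a₁, a₂, a₃, b₁, b₂, b₃, x₁, x₂} : Set E), f {p} = 1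
  rank_pair : ∀ p ∈ ({O, a₁, a₂, a₃, b₁, b₂, b₃, x₁, x₂} : Set E),
    ∀ q ∈ ({O, a₁, a₂, a₃, b₁, b₂, b₃, x₁, x₂} : Set E), p ≠ q → f {p, q} = 2
  perspective₁ : f {O, a₁, b₁} = 2
  perspective₂ : f {O, a₂, b₂} = 2
  perspective₃ : f {O, a₃, b₃} = 2
  a_x₁ : f {a₂, a₃, x₁} = 2
  b_x₁ : f {b₂, b₃, x₁} = 2
  a_x₂ : f {a₁, a₃, x₂} = 2
  b_x₂ : f {b₁, b₃, x₂} = 2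
  rank_four : f {O, a₁, a₂, a₃} = 4

/-!
The element `x₃` is constructed with the Ahlswede–Körner lemma
(`IsAlmostEntropic.exists_isAhlswedeKorner`): for finite sets `A` and `B`, an almost entropic `f`
has an almost entropic extension by one element `w` that is spanned by `A`, whose rank is at most
the mutual information `f A + f B - f (A ∪ B)`, and that satisfies
`f' (S ∪ w) - f' w ≤ f (S ∪ B) - f B` for all `S ⊆ A`. Take `A = {a₁, a₂, b₁, b₂}`, a plane, and `B = {x₁, x₂}`, a line that
meets this plane in rank one (`IsDesarguesConfiguration.rank_union_eq_four`). Then `w` has rank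
one and lies on `a₁a₂` and `b₁b₂`. That it is collinear with `x₁` and `x₂` is the classical proof
of Desargues' theorem in space: the planes of the two triangles intersect in rank two, by
submodularity (`IsDesarguesConfiguration.collinear`). This applies to any other common point of the
two lines as well, and it is parallel to `w` because the lines span a plane
(`IsDesarguesConfiguration.parallel`).

To prove the lemma for an entropic polymatroid, take the positions of a sequence of length about
`N` whose letters `ω` have frequencies `P ω`, and permute the positions by a uniformly distributed
element of the group `G` of permutations. The variables read along the permuted sequence are then
cosets of stabilizers in `G`. By Stirling's formula, the logarithms of the indices of these
stabilizers, divided by `N`, tend to the original entropies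
(`tendsto_logb_card_div_valueStabilizer`). For two subgroups `A` and `B` of `G`,
`|G| |A ∩ B| / (|A| |B|)` translates of the product set `B A` suffice, up to a factor logarithmic
in `|G|`, to cover `G`, and the choice of a translate that contains a given coset of `A` is the new variable (`exists_covering_variable`).
Division by `N` is achieved by revealing all variables only with probability `1 / N`
(`entropy_mixNone`).

The limits for `N → ∞` and for entropic polymatroids tending to `f` are taken along ultrafilters,
because the ground set can be uncountable; they exist since the rank of `w` stays bounded. The
limit need not be of finite type, but its finite type part (`finiteTypePart`) is a pointwise limit
of restrictions to finite sets, hence is almost entropic.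
-/

/-! ### Shannon inequalities -/

theorem probEq_eq_sum_ite {Ω : Type*} [Fintype Ω] (P : Ω → ℝ) {V : Type*} [DecidableEq V]
    (X : Ω → V) (x : V) : probEq P X x = ∑ ω : Ω, if X ω = x then P ω else 0 := by
  simp [probEq, Set.indicator_apply]

theorem probEq_nonneg {Ω : Type*} [Fintype Ω] {P : Ω → ℝ} (hP : ∀ ω, 0 ≤ P ω) {V : Type*}
    (X : Ω → V) (x : V) : 0 ≤ probEq P X x :=
  Finset.sum_nonneg fun _ _ => Set.indicator_nonneg (fun ω _ => hP ω) _

theorem le_probEq {Ω : Type*} [Fintype Ω] {P : Ω → ℝ} (hP : ∀ ω, 0 ≤ P ω) {V : Type*}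
    (X : Ω → V) (ω : Ω) : P ω ≤ probEq P X (X ω) := by
  classical
  rw [probEq_eq_sum_ite]
  refine le_trans (by simp) (Finset.single_le_sum
    (f := fun ω' => if X ω' = X ω then P ω' else 0) (fun i _ => ?_) (Finset.mem_univ ω))
  split_ifs
  exacts [hP _, le_rfl]

theorem probEq_le_of_imp {Ω : Type*} [Fintype Ω] {P : Ω → ℝ} (hP : ∀ ω, 0 ≤ P ω) {V W : Type*}
    {X : Ω → V} {Y : Ω → W} (h : ∀ ω ω', Y ω = Y ω' → X ω = X ω') (ω : Ω) :
    probEq P Y (Y ω) ≤ probEq P X (X ω) := by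
  classical
  rw [probEq_eq_sum_ite, probEq_eq_sum_ite]
  refine Finset.sum_le_sum fun ω' _ => ?_
  by_cases hY : Y ω' = Y ω
  · simp [hY, h _ _ hY]
  · simp only [hY, if_false]
    split_ifs
    exacts [hP _, le_rfl]

/-- A variable that is determined by another one has the smaller entropy. -/
theorem entropy_le_of_imp {Ω : Type*} [Fintype Ω] {P : Ω → ℝ} (hP : ∀ ω, 0 ≤ P ω) {V W : Type*}
    {X : Ω → V} {Y : Ω → W} (h : ∀ ω ω', Y ω = Y ω' → X ω = X ω') :
    entropy P X ≤ entropy P Y := by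
  rw [entropy_eq_sum, entropy_eq_sum]
  refine Finset.sum_le_sum fun ω _ => ?_
  rcases (hP ω).eq_or_lt with h0 | hpos
  · simp [← h0]
  · have hY : 0 < probEq P Y (Y ω) := hpos.trans_le (le_probEq hP Y ω)
    have := probEq_le_of_imp hP h ω
    have hX : 0 < probEq P X (X ω) := hY.trans_le this
    refine mul_le_mul_of_nonneg_left (Real.logb_le_logb_of_le one_lt_two (by positivity) ?_) hpos.le
    exact one_div_le_one_div_of_le hY this

theorem entropy_const {Ω : Type*} [Fintype Ω] {P : Ω → ℝ} (hP : P ∈ stdSimplex ℝ Ω) {V : Type*}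
    {X : Ω → V} (h : ∀ ω ω', X ω = X ω') : entropy P X = 0 := by
  rw [entropy_eq_sum]
  refine Finset.sum_eq_zero fun ω _ => ?_
  have : probEq P X (X ω) = 1 := by
    classical
    rw [probEq_eq_sum_ite, ← hP.2]
    exact Finset.sum_congr rfl fun ω' _ => by simp [h ω' ω]
  simp [this]

/-- Gibbs' inequality, in the form in which both submodularity and the bound for a conditional
entropy use it. -/
theorem sum_mul_logb_le {Ω : Type*} [Fintype Ω] {P : Ω → ℝ} (hP : P ∈ stdSimplex ℝ Ω)
    {t : Ω → ℝ} (ht : ∀ ω, 0 < P ω → 0 < t ω) {m : ℝ} (hm : 0 < m)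
    (h : ∑ ω, P ω * t ω ≤ m) : ∑ ω, P ω * Real.logb 2 (t ω) ≤ Real.logb 2 m := by
  have hl : (0 : ℝ) < Real.log 2 := Real.log_pos one_lt_two
  have key : ∀ ω, P ω * Real.log (t ω) ≤ P ω * t ω / m - P ω + P ω * Real.log m := by
    intro ω
    rcases (hP.1 ω).eq_or_lt with h0 | hpos
    · simp [← h0]
    · have ht' := ht ω hpos
      have h1 := Real.log_le_sub_one_of_pos (div_pos ht' hm)
      rw [Real.log_div ht'.ne' hm.ne'] at h1
      have h2 := mul_le_mul_of_nonneg_left h1 hpos.le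
      have h3 : P ω * (t ω / m - 1) = P ω * t ω / m - P ω := by ring
      linarith
  have hsum : ∑ ω, P ω * Real.log (t ω) ≤ Real.log m := by
    refine (Finset.sum_le_sum fun ω _ => key ω).trans ?_
    rw [Finset.sum_add_distrib, Finset.sum_sub_distrib, ← Finset.sum_mul, ← Finset.sum_div, hP.2]
    have : (∑ ω, P ω * t ω) / m ≤ 1 := (div_le_one hm).2 h
    linarith
  simp only [Real.logb, ← mul_div_assoc, ← Finset.sum_div]
  exact div_le_div_of_nonneg_right hsum hl.le

/-- The conditional probabilities of an event given the value of a variable sum to at most one. -/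
theorem sum_ite_div_probEq_le_one {Ω : Type*} [Fintype Ω] (P : Ω → ℝ) {V : Type*}
    [DecidableEq V] (X : Ω → V) (x : V) :
    ∑ ω, (if X ω = x then P ω / probEq P X (X ω) else 0) ≤ 1 := by
  have : ∑ ω, (if X ω = x then P ω / probEq P X (X ω) else 0) =
      probEq P X x / probEq P X x := by
    conv_rhs => rw [div_eq_mul_inv, probEq_eq_sum_ite P X x, Finset.sum_mul]
    rw [← probEq_eq_sum_ite P X x]
    refine Finset.sum_congr rfl fun ω _ => ?_
    split_ifs with h
    · rw [h, div_eq_mul_inv]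
    · simp
  rw [this]
  exact div_self_le_one _

theorem entropy_submodular {Ω : Type*} [Fintype Ω] {P : Ω → ℝ} (hP : P ∈ stdSimplex ℝ Ω)
    {U V W : Type*} {X : Ω → U} {Y : Ω → V} {Z : Ω → W}
    (hX : ∀ ω ω', X ω = X ω' → Z ω = Z ω') (hY : ∀ ω ω', Y ω = Y ω' → Z ω = Z ω') :
    entropy P (fun ω => (X ω, Y ω)) + entropy P Z ≤ entropy P X + entropy P Y := by
  classical
  set XY : Ω → U × V := fun ω => (X ω, Y ω) with hXY
  have h0 := hP.1
  have posU : ∀ ω : Ω, 0 < P ω → 0 < probEq P X (X ω) := fun ω h => h.trans_le (le_probEq h0 X ω)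
  have posV : ∀ ω : Ω, 0 < P ω → 0 < probEq P Y (Y ω) := fun ω h => h.trans_le (le_probEq h0 Y ω)
  have posW : ∀ ω : Ω, 0 < P ω → 0 < probEq P Z (Z ω) := fun ω h => h.trans_le (le_probEq h0 Z ω)
  have posUV : ∀ ω : Ω, 0 < P ω → 0 < probEq P XY (XY ω) :=
    fun ω h => h.trans_le (le_probEq h0 XY ω)
  -- sum first over the values of `Y` that are compatible with `X = X ω'`: all of them have the
  -- same value of `Z`
  have inner : ∀ ω', ∑ ω, (if X ω' = X ω then P ω * probEq P Y (Y ω) / probEq P XY (XY ω) else 0)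
      ≤ probEq P Z (Z ω') := by
    intro ω'
    have e1 : ∑ ω, (if X ω' = X ω then P ω * probEq P Y (Y ω) / probEq P XY (XY ω) else 0) =
        ∑ ω'', P ω'' * ∑ ω, (if XY ω = (X ω', Y ω'') then P ω / probEq P XY (XY ω) else 0) := by
      simp only [Finset.mul_sum]
      rw [Finset.sum_comm]
      refine Finset.sum_congr rfl fun ω _ => ?_
      rw [probEq_eq_sum_ite P Y]
      split_ifs with h
      · rw [Finset.mul_sum, Finset.sum_div]
        refine Finset.sum_congr rfl fun ω'' _ => ?_
        by_cases h2 : Y ω'' = Y ω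
        · simp [hXY, h, h2]; ring
        · simp [hXY, h2, Ne.symm h2]
      · symm
        refine Finset.sum_eq_zero fun ω'' _ => ?_
        simp [hXY, Ne.symm h]
    rw [e1, probEq_eq_sum_ite]
    refine Finset.sum_le_sum fun ω'' _ => ?_
    split_ifs with hZ
    · exact mul_le_of_le_one_right (h0 _) (sum_ite_div_probEq_le_one P XY _)
    · refine le_of_eq (mul_eq_zero_of_right _ (Finset.sum_eq_zero fun ω _ => if_neg fun h => hZ ?_))
      have h' := Prod.ext_iff.1 h
      exact (hY _ _ h'.2).symm.trans (hX _ _ h'.1)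
  have bound : ∑ ω, P ω * (probEq P X (X ω) * probEq P Y (Y ω) /
      (probEq P XY (XY ω) * probEq P Z (Z ω))) ≤ 1 := by
    have e2 : ∑ ω, P ω * (probEq P X (X ω) * probEq P Y (Y ω) /
        (probEq P XY (XY ω) * probEq P Z (Z ω))) =
        ∑ ω', P ω' / probEq P Z (Z ω') *
        ∑ ω, (if X ω' = X ω then P ω * probEq P Y (Y ω) / probEq P XY (XY ω) else 0) := by
      simp only [Finset.mul_sum]
      rw [Finset.sum_comm]
      refine Finset.sum_congr rfl fun ω _ => ?_
      rw [probEq_eq_sum_ite P X, Finset.sum_mul, Finset.sum_div, Finset.mul_sum]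
      refine Finset.sum_congr rfl fun ω' _ => ?_
      split_ifs with h
      · rw [hX _ _ h]
        field_simp
      · simp
    rw [e2, ← hP.2]
    refine Finset.sum_le_sum fun ω' _ => ?_
    refine (mul_le_mul_of_nonneg_left (inner ω')
      (div_nonneg (h0 _) (probEq_nonneg h0 _ _))).trans ?_
    rcases (h0 ω').eq_or_lt with h | h
    · simp [← h]
    · rw [div_mul_cancel₀ _ (posW ω' h).ne']
  have key := sum_mul_logb_le hP (t := fun ω => probEq P X (X ω) * probEq P Y (Y ω) /
      (probEq P XY (XY ω) * probEq P Z (Z ω))) (fun ω h => by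
        have := posU ω h; have := posV ω h; have := posW ω h; have := posUV ω h
        positivity) one_pos bound
  have e3 : ∑ ω, P ω * Real.logb 2 (probEq P X (X ω) * probEq P Y (Y ω) /
      (probEq P XY (XY ω) * probEq P Z (Z ω))) =
      entropy P XY + entropy P Z - entropy P X - entropy P Y := by
    simp only [entropy_eq_sum]
    rw [← Finset.sum_add_distrib, ← Finset.sum_sub_distrib, ← Finset.sum_sub_distrib]
    refine Finset.sum_congr rfl fun ω _ => ?_
    rcases (h0 ω).eq_or_lt with h | h
    · simp [← h]
    · have h1 := (posU ω h).ne'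
      have h2 := (posV ω h).ne'
      have h3 := (posW ω h).ne'
      have h4 := (posUV ω h).ne'
      rw [Real.logb_div (mul_ne_zero h1 h2) (mul_ne_zero h4 h3), Real.logb_mul h1 h2,
        Real.logb_mul h4 h3]
      simp only [one_div, Real.logb_inv]
      ring
  rw [e3, Real.logb_one] at key
  linarith

/-- If `Z` takes at most `m` values once `W` is known, then `H(Z | W) ≤ log m`. -/
theorem entropy_pair_le {Ω : Type*} [Fintype Ω] {P : Ω → ℝ} (hP : P ∈ stdSimplex ℝ Ω)
    {V W : Type*} (Z : Ω → V) (Y : Ω → W) {m : ℝ} (hm : 0 < m)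
    (h : ∀ ω, ((Z '' {ω' | Y ω' = Y ω}).ncard : ℝ) ≤ m) :
    entropy P (fun ω => (Z ω, Y ω)) ≤ entropy P Y + Real.logb 2 m := by
  classical
  set ZY : Ω → V × W := fun ω => (Z ω, Y ω) with hZY
  have h0 := hP.1
  have posY : ∀ ω : Ω, 0 < P ω → 0 < probEq P Y (Y ω) := fun ω h => h.trans_le (le_probEq h0 Y ω)
  have posZ : ∀ ω : Ω, 0 < P ω → 0 < probEq P ZY (ZY ω) :=
    fun ω h => h.trans_le (le_probEq h0 ZY ω)
  have inner : ∀ ω', ∑ ω, (if Y ω' = Y ω then P ω / probEq P ZY (ZY ω) else 0) ≤ m := by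
    intro ω'
    refine le_trans ?_ (h ω')
    set F : Finset V := (Finset.univ.filter fun ω => Y ω = Y ω').image Z with hF
    have hcard : (Z '' {ω | Y ω = Y ω'}).ncard = F.card := by
      rw [← Set.ncard_coe_finset, hF]
      simp
    have hsplit : ∑ ω, (if Y ω' = Y ω then P ω / probEq P ZY (ZY ω) else 0) =
        ∑ z ∈ F, ∑ ω, (if ZY ω = (z, Y ω') then P ω / probEq P ZY (ZY ω) else 0) := by
      rw [Finset.sum_comm]
      refine Finset.sum_congr rfl fun ω _ => ?_
      split_ifs with hy
      · rw [Finset.sum_eq_single_of_mem (Z ω)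
          (Finset.mem_image_of_mem Z (by simp [hy])) fun z _ hz => if_neg ?_]
        · simp [hZY, hy]
        · simp [hZY, Ne.symm hz]
      · exact (Finset.sum_eq_zero fun z _ => by simp [hZY, Ne.symm hy]).symm
    rw [hsplit, hcard]
    refine (Finset.sum_le_sum fun z _ => sum_ite_div_probEq_le_one P ZY (z, Y ω')).trans ?_
    simp
  have bound : ∑ ω, P ω * (probEq P Y (Y ω) / probEq P ZY (ZY ω)) ≤ m := by
    have e2 : ∑ ω, P ω * (probEq P Y (Y ω) / probEq P ZY (ZY ω)) =
        ∑ ω', P ω' * ∑ ω, (if Y ω' = Y ω then P ω / probEq P ZY (ZY ω) else 0) := by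
      simp only [Finset.mul_sum]
      rw [Finset.sum_comm]
      refine Finset.sum_congr rfl fun ω _ => ?_
      rw [probEq_eq_sum_ite P Y, Finset.sum_div, Finset.mul_sum]
      refine Finset.sum_congr rfl fun ω' _ => ?_
      split_ifs with h
      · ring
      · simp
    rw [e2]
    refine (Finset.sum_le_sum fun ω' _ => mul_le_mul_of_nonneg_left (inner ω') (h0 _)).trans ?_
    rw [← Finset.sum_mul, hP.2, one_mul]
  have key := sum_mul_logb_le hP (t := fun ω => probEq P Y (Y ω) / probEq P ZY (ZY ω))
    (fun ω h => div_pos (posY ω h) (posZ ω h)) hm bound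
  have e3 : ∑ ω, P ω * Real.logb 2 (probEq P Y (Y ω) / probEq P ZY (ZY ω)) =
      entropy P ZY - entropy P Y := by
    simp only [entropy_eq_sum]
    rw [← Finset.sum_sub_distrib]
    refine Finset.sum_congr rfl fun ω _ => ?_
    rcases (h0 ω).eq_or_lt with h | h
    · simp [← h]
    · rw [Real.logb_div (posY ω h).ne' (posZ ω h).ne']
      simp only [one_div, Real.logb_inv]
      ring
  rw [e3] at key
  linarith

theorem entropy_le_logb_ncard {Ω : Type*} [Fintype Ω] {P : Ω → ℝ} (hP : P ∈ stdSimplex ℝ Ω)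
    {V : Type*} (Z : Ω → V) {m : ℝ} (hm : 0 < m) (h : ((Set.range Z).ncard : ℝ) ≤ m) :
    entropy P Z ≤ Real.logb 2 m := by
  have h1 := entropy_pair_le hP Z (fun _ => ()) hm (fun _ => by simpa using h)
  rw [entropy_const hP (X := fun _ : Ω => ()) (fun _ _ => rfl), zero_add] at h1
  refine le_trans (le_of_eq (entropy_congr P _ _ fun ω ω' => ?_)) h1
  simp

theorem IsEntropic.isPolymatroid {E : Type*} {h : Set E → ℝ} (hh : IsEntropic h) :
    IsPolymatroid h := by
  obtain ⟨Ω, _, P, V, X, hP, hX⟩ := hh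
  refine ⟨?_, fun A B hAB => ?_, fun A B => ?_⟩
  · rw [hX]
    exact entropy_const hP fun ω ω' => funext fun i => i.2.elim
  · rw [hX, hX]
    refine entropy_le_of_imp hP.1 fun ω ω' H => funext fun i => ?_
    exact congrFun H ⟨i, hAB i.2⟩
  · simp only [hX]
    refine le_trans (le_of_eq ?_) (entropy_submodular hP
      (Z := fun ω (i : ↥(A ∩ B)) => X i ω) (fun ω ω' H => funext fun i => ?_)
      fun ω ω' H => funext fun i => ?_)
    · congr 1
      refine entropy_congr P _ _ fun ω ω' => ?_
      simp only [Prod.mk.injEq, funext_iff, Subtype.forall, Set.mem_union]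
      exact ⟨fun H => ⟨fun i hi => H i (.inl hi), fun i hi => H i (.inr hi)⟩,
        fun H i hi => hi.elim (H.1 i) (H.2 i)⟩
    · exact congrFun H ⟨i, i.2.1⟩
    · exact congrFun H ⟨i, i.2.2⟩

/-! ### Mixing a variable with a constant -/

/-- The distribution on `Option Ω` that gives mass `1 - t` to `none` and distributes the mass `t`
on `Ω` proportionally to `P`. -/
noncomputable def mixNone {Ω : Type*} (P : Ω → ℝ) (t : ℝ) : Option Ω → ℝ :=
  fun o => o.elim (1 - t) fun ω => t * P ω

theorem mixNone_mem_stdSimplex {Ω : Type*} [Fintype Ω] {P : Ω → ℝ} (hP : P ∈ stdSimplex ℝ Ω)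
    {t : ℝ} (ht : 0 ≤ t) (ht' : t ≤ 1) : mixNone P t ∈ stdSimplex ℝ (Option Ω) := by
  refine ⟨fun o => ?_, ?_⟩
  · cases o with
    | none => exact sub_nonneg.2 ht'
    | some ω => exact mul_nonneg ht (hP.1 ω)
  · simp [Fintype.sum_option, mixNone, ← Finset.mul_sum, hP.2]

/-- Observing a variable only with probability `t` scales its entropy by `t`, up to the entropy of
the choice whether it is observed. -/
theorem entropy_mixNone {Ω : Type*} [Fintype Ω] {P : Ω → ℝ} (hP : P ∈ stdSimplex ℝ Ω)
    {t : ℝ} (ht : 0 < t) {V : Type*} (X : Ω → V) :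
    entropy (mixNone P t) (Option.map X) = Real.binEntropy t / Real.log 2 + t * entropy P X := by
  classical
  have h1 : probEq (mixNone P t) (Option.map X) none = 1 - t := by
    rw [probEq_eq_sum_ite, Fintype.sum_option]
    simp [mixNone]
  have h2 : ∀ x, probEq (mixNone P t) (Option.map X) (some x) = t * probEq P X x := by
    intro x
    rw [probEq_eq_sum_ite, Fintype.sum_option, probEq_eq_sum_ite]
    simp [mixNone, Finset.mul_sum]
  have h3 : ∀ ω, t * P ω * Real.logb 2 (1 / (t * probEq P X (X ω))) =
      P ω * (t * Real.logb 2 (1 / t)) + t * (P ω * Real.logb 2 (1 / probEq P X (X ω))) := by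
    intro ω
    rcases (hP.1 ω).eq_or_lt with h | h
    · simp [← h]
    · have hX : probEq P X (X ω) ≠ 0 := (h.trans_le (le_probEq hP.1 X ω)).ne'
      simp only [one_div, Real.logb_inv]
      rw [Real.logb_mul ht.ne' hX]
      ring
  rw [entropy_eq_sum, entropy_eq_sum, Fintype.sum_option]
  simp only [Option.map_none, Option.map_some, h1, h2]
  have h4 : ∑ ω, mixNone P t (some ω) * Real.logb 2 (1 / (t * probEq P X (X ω))) =
      t * Real.logb 2 (1 / t) + t * ∑ ω, P ω * Real.logb 2 (1 / probEq P X (X ω)) := by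
    simp only [mixNone, Option.elim, h3]
    rw [Finset.sum_add_distrib, ← Finset.sum_mul, hP.2, one_mul, Finset.mul_sum]
  rw [h4]
  simp only [mixNone, Option.elim, Real.binEntropy, Real.logb, one_div]
  ring

/-! ### Uniform distributions on finite groups -/

theorem uniform_mem_stdSimplex (G : Type*) [Fintype G] [Nonempty G] :
    (fun _ : G => (Nat.card G : ℝ)⁻¹) ∈ stdSimplex ℝ G := by
  refine ⟨fun _ => by positivity, ?_⟩
  simp

/-- A variable on a finite group whose level sets are the left cosets of `D` is uniformly
distributed on `[G : D]` values. -/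
theorem entropy_coset {G : Type*} [Group G] [Fintype G] (D : Subgroup G) {V : Type*} (Z : G → V)
    (hZ : ∀ g g', Z g = Z g' ↔ g⁻¹ * g' ∈ D) :
    entropy (fun _ : G => (Nat.card G : ℝ)⁻¹) Z =
      Real.logb 2 ((Nat.card G : ℝ) / Nat.card D) := by
  classical
  have hp : ∀ g, probEq (fun _ : G => (Nat.card G : ℝ)⁻¹) Z (Z g) =
      (Nat.card D : ℝ) / Nat.card G := by
    intro g
    rw [probEq_eq_sum_ite, ← Finset.sum_filter, Finset.sum_const, nsmul_eq_mul, div_eq_mul_inv]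
    congr 2
    rw [← Fintype.card_subtype, ← Nat.card_eq_fintype_card]
    refine Nat.card_congr ((Equiv.mulLeft g⁻¹).subtypeEquiv fun g' => ?_)
    rw [eq_comm, hZ]
    rfl
  rw [entropy_eq_sum]
  simp only [hp, one_div_div]
  simp

/-- A variable whose level sets are the left cosets of `D` takes `[B : B ⊓ D]` values on each
translate of `B`. -/
theorem ncard_image_coset {G : Type*} [Group G] [Fintype G] (B D : Subgroup G) {V : Type*}
    (Z : G → V) (hZ : ∀ g g', Z g = Z g' ↔ g⁻¹ * g' ∈ D) (c : G) :
    (Z '' ((fun b => c * b) '' (B : Set G))).ncard * Nat.card ↥(B ⊓ D) = Nat.card B := by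
  classical
  have e : ↥B ⧸ (D.subgroupOf B) ≃ ↥(Z '' ((fun b => c * b) '' (B : Set G))) := by
    refine Equiv.ofBijective (Quotient.lift (fun b : B =>
      ⟨Z (c * b), Set.mem_image_of_mem Z (Set.mem_image_of_mem _ b.2)⟩)
      fun b b' h => ?_) ⟨fun q q' => ?_, ?_⟩
    · have := QuotientGroup.leftRel_apply.1 h
      rw [Subgroup.mem_subgroupOf] at this
      refine Subtype.ext ((hZ _ _).2 ?_)
      simpa [mul_assoc] using this
    · induction q using Quotient.inductionOn with | _ b
      induction q' using Quotient.inductionOn with | _ b'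
      intro h
      have h' : Z (c * b) = Z (c * b') := congrArg Subtype.val h
      rw [hZ] at h'
      refine Quotient.sound (QuotientGroup.leftRel_apply.2 (Subgroup.mem_subgroupOf.2 ?_))
      simpa [mul_assoc] using h'
    · rintro ⟨_, _, ⟨b, hb, rfl⟩, rfl⟩
      exact ⟨Quotient.mk _ ⟨b, hb⟩, rfl⟩
  have h1 := Subgroup.card_eq_card_quotient_mul_card_subgroup (D.subgroupOf B)
  rw [h1, Nat.card_congr e, Nat.card_coe_set_eq]
  congr 1
  refine Nat.card_congr ⟨fun x => ⟨⟨x, x.2.1⟩, x.2.2⟩, fun x => ⟨x.1, x.1.2, x.2⟩,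
    fun _ => rfl, fun _ => rfl⟩

/-- Covering a finite group by translates of a subset, greedily: one can always add a translate
that covers at least the average proportion `|K| / |G|` of what is not yet covered. -/
theorem exists_uncovered_le {G : Type*} [Group G] [Fintype G] [DecidableEq G] (K : Finset G)
    (n : ℕ) : ∃ C : Finset G, C.card ≤ n ∧
      (((Finset.univ.filter fun g => ∀ c ∈ C, c⁻¹ * g ∉ K).card : ℕ) : ℝ) ≤
        Fintype.card G * (1 - (K.card : ℝ) / Fintype.card G) ^ n := by
  induction n with
  | zero => exact ⟨∅, by simp, by simp⟩
  | succ n ih =>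
    obtain ⟨C, hC, hU⟩ := ih
    set U := Finset.univ.filter fun g => ∀ c ∈ C, c⁻¹ * g ∉ K with hUdef
    have hG : (0 : ℝ) < Fintype.card G := by exact_mod_cast Fintype.card_pos
    have hsum : ∑ c : G, (U.filter fun g => c⁻¹ * g ∈ K).card = U.card * K.card := by
      simp only [Finset.card_filter]
      rw [Finset.sum_comm, Finset.card_eq_sum_ones, Finset.sum_mul]
      refine Finset.sum_congr rfl fun g _ => ?_
      rw [← Finset.card_filter, one_mul]
      refine Finset.card_nbij' (fun c => c⁻¹ * g) (fun k => g * k⁻¹) ?_ ?_ ?_ ?_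
      · intro c hc; simpa using hc
      · intro k hk; simpa using hk
      · intro c _; simp
      · intro k _; simp
    obtain ⟨c, -, hc⟩ : ∃ c ∈ (Finset.univ : Finset G),
        (U.card * K.card : ℝ) / Fintype.card G ≤ ((U.filter fun g => c⁻¹ * g ∈ K).card : ℝ) := by
      refine Finset.exists_le_of_sum_le Finset.univ_nonempty ?_
      rw [Finset.sum_const, Finset.card_univ, nsmul_eq_mul, mul_div_cancel₀ _ hG.ne']
      exact_mod_cast hsum.ge
    refine ⟨insert c C, (Finset.card_insert_le _ _).trans (by omega), ?_⟩
    have hsub : (Finset.univ.filter fun g => ∀ c' ∈ insert c C, c'⁻¹ * g ∉ K) =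
        U.filter fun g => ¬ (c⁻¹ * g ∈ K) := by
      ext g
      simp [hUdef, and_comm]
    have hsplit := Finset.card_filter_add_card_filter_not (s := U) (fun g => c⁻¹ * g ∈ K)
    rw [hsub]
    have hsplit' : ((U.filter fun g => c⁻¹ * g ∈ K).card : ℝ) +
      (U.filter fun g => ¬ (c⁻¹ * g ∈ K)).card = U.card := by exact_mod_cast hsplit
    have hK : (K.card : ℝ) / Fintype.card G ≤ 1 :=
      (div_le_one hG).2 (by exact_mod_cast K.card_le_univ)
    have := mul_le_mul_of_nonneg_right hU (sub_nonneg.2 hK)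
    rw [pow_succ, ← mul_assoc]
    refine le_trans ?_ this
    rw [mul_one_sub, ← mul_div_assoc]
    linarith

theorem exists_cover {G : Type*} [Group G] [Fintype G] [DecidableEq G] (K : Finset G)
    (hK : K.Nonempty) : ∃ C : Finset G, (∀ g, ∃ c ∈ C, c⁻¹ * g ∈ K) ∧
      (C.card : ℝ) ≤ (Fintype.card G : ℝ) / K.card * (Real.log (Fintype.card G) + 1) := by
  have hG : (0 : ℝ) < Fintype.card G := by exact_mod_cast Fintype.card_pos
  have hG1 : (1 : ℝ) ≤ Fintype.card G := by exact_mod_cast Fintype.card_pos (α := G)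
  have hK0 : (0 : ℝ) < K.card := by exact_mod_cast hK.card_pos
  set r := (Fintype.card G : ℝ) / K.card * Real.log (Fintype.card G) with hr
  have hr0 : 0 ≤ r := mul_nonneg (by positivity) (Real.log_nonneg hG1)
  -- after `n > r` steps fewer than `|G| * exp (-n * |K| / |G|) < 1` elements are left
  obtain ⟨C, hC, hU⟩ := exists_uncovered_le K (⌊r⌋₊ + 1)
  refine ⟨C, ?_, ?_⟩
  · have hlt : (Fintype.card G : ℝ) * (1 - (K.card : ℝ) / Fintype.card G) ^ (⌊r⌋₊ + 1) < 1 := by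
      have hle : (K.card : ℝ) / Fintype.card G ≤ 1 :=
        (div_le_one hG).2 (by exact_mod_cast K.card_le_univ)
      have h1 : (1 - (K.card : ℝ) / Fintype.card G) ^ (⌊r⌋₊ + 1) ≤
          Real.exp (-((K.card : ℝ) / Fintype.card G)) ^ (⌊r⌋₊ + 1) :=
        pow_le_pow_left₀ (sub_nonneg.2 hle) (Real.one_sub_le_exp_neg _) _
      rw [← Real.exp_nat_mul] at h1
      have h2 : Real.exp (((⌊r⌋₊ + 1 : ℕ) : ℝ) * -((K.card : ℝ) / Fintype.card G)) <
          Real.exp (-Real.log (Fintype.card G)) := by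
        rw [Real.exp_lt_exp]
        have h3 := Nat.lt_floor_add_one r
        have h4 : r * ((K.card : ℝ) / Fintype.card G) = Real.log (Fintype.card G) := by
          rw [hr]; field_simp
        have h5 := mul_lt_mul_of_pos_right h3 (div_pos hK0 hG)
        rw [h4] at h5
        push_cast
        linarith
      rw [Real.exp_neg, Real.exp_log hG] at h2
      calc _ < (Fintype.card G : ℝ) * (Fintype.card G : ℝ)⁻¹ :=
            mul_lt_mul_of_pos_left (h1.trans_lt h2) hG
        _ = 1 := mul_inv_cancel₀ hG.ne'
    have h0 := hU.trans_lt hlt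
    rw [Nat.cast_lt_one, Finset.card_eq_zero, Finset.filter_eq_empty_iff] at h0
    intro g
    have := h0 (Finset.mem_univ g)
    push Not at this
    exact this
  · refine (Nat.cast_le.2 hC).trans ?_
    have h1 : (1 : ℝ) ≤ (Fintype.card G : ℝ) / K.card :=
      (one_le_div hK0).2 (by exact_mod_cast K.card_le_univ)
    push_cast
    rw [mul_add_one, ← hr]
    linarith [Nat.floor_le hr0]

open scoped Pointwise in
/-- The combinatorial core of the Ahlswede–Körner lemma. The sets `c * B * A`, for `c` in a small
set `C`, cover `G`; the variable `w` selects for each left coset of `A` some `c` such that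
`c * B * A` contains it. Once `w` is known, a coset of a subgroup `D ≥ A` can take
only as many values as if a coset of `B` were known. -/
theorem exists_covering_variable {G : Type*} [Group G] [Fintype G] (A B : Subgroup G) :
    ∃ w : G → G, (∀ g g', g⁻¹ * g' ∈ A → w g = w g') ∧
      ((Set.range w).ncard : ℝ) ≤ (Nat.card G : ℝ) * Nat.card ↥(B ⊓ A) /
        (Nat.card A * Nat.card B) * (Real.log (Nat.card G) + 1) ∧
      ∀ D : Subgroup G, A ≤ D → ∀ {V : Type*} (Z : G → V),
        (∀ g g', Z g = Z g' ↔ g⁻¹ * g' ∈ D) → ∀ g,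
          ((Z '' {g' | w g' = w g}).ncard : ℝ) ≤ (Nat.card B : ℝ) / Nat.card ↥(B ⊓ D) := by
  classical
  let K : Set G := (B : Set G) * (A : Set G)
  have hKcard : K.toFinset.card * Nat.card ↥(B ⊓ A) = Nat.card A * Nat.card B := by
    have h1 := Subgroup.card_mul_eq_card_subgroup_mul_card_quotient A (B : Set G)
    have h2 := ncard_image_coset B A (fun g : G => (g : G ⧸ A))
      (fun g g' => QuotientGroup.eq) 1
    simp only [one_mul, Set.image_id'] at h2
    rw [← Set.ncard_eq_toFinset_card', ← Nat.card_coe_set_eq, h1, mul_assoc, Nat.card_coe_set_eq,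
      h2]
  have hKne : K.toFinset.Nonempty := 
    ⟨1, Set.mem_toFinset.2 ⟨1, B.one_mem, 1, A.one_mem, one_mul 1⟩⟩
  obtain ⟨C, hcov, hC⟩ := exists_cover K.toFinset hKne
  -- choose the index as a function of the coset `g A`
  have hchoice : ∀ q : G ⧸ A, ∃ c ∈ C, c⁻¹ * q.out ∈ K := fun q => by
    simpa using hcov q.out
  choose v hvC hv using hchoice
  have hmem : ∀ g : G, (v g)⁻¹ * g ∈ K := by
    intro g
    obtain ⟨b, hb, a, ha, hab⟩ := hv g
    obtain ⟨a', ha'⟩ := QuotientGroup.mk_out_eq_mul A g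
    refine ⟨b, hb, a * (a' : G)⁻¹, A.mul_mem ha (A.inv_mem a'.2), ?_⟩
    rw [ha'] at hab
    simp only at hab ⊢
    rw [← mul_assoc, hab]
    group
  refine ⟨fun g => v g, fun g g' h => ?_, ?_, fun D hAD V Z hZ g => ?_⟩
  · simp only
    rw [QuotientGroup.eq.2 h]
  · have hsub : Set.range (fun g : G => v g) ⊆ (C : Set G) := by
      rintro _ ⟨g, rfl⟩
      exact hvC _
    have h1 : (Set.range (fun g : G => v g)).ncard ≤ C.card := by
      rw [← Set.ncard_coe_finset]
      exact Set.ncard_le_ncard hsub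
    refine (Nat.cast_le.2 h1).trans (hC.trans (le_of_eq ?_))
    have h2 : (0 : ℝ) < K.toFinset.card := by exact_mod_cast hKne.card_pos
    have h3 : (0 : ℝ) < Nat.card ↥(B ⊓ A) := by exact_mod_cast Nat.card_pos
    have hKcard' : (K.toFinset.card : ℝ) * Nat.card ↥(B ⊓ A) = Nat.card A * Nat.card B := by
      exact_mod_cast hKcard
    rw [← hKcard', ← Nat.card_eq_fintype_card, mul_div_mul_right _ _ h3.ne']
  · have hsub : Z '' {g' | (fun g : G => v g) g' = (fun g : G => v g) g} ⊆
        Z '' ((fun b => v g * b) '' (B : Set G)) := by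
      rintro _ ⟨g', hg', rfl⟩
      obtain ⟨b, hb, a, ha, hab⟩ := hmem g'
      simp only [Set.mem_ofPred_eq] at hg'
      refine ⟨v g * b, ⟨b, hb, rfl⟩, (hZ _ _).2 (hAD ?_)⟩
      rw [hg'] at hab
      simp only at hab
      have : (v g * b)⁻¹ * g' = a := by
        rw [mul_inv_rev, mul_assoc, ← hab]
        group
      rw [this]
      exact ha
    have h1 := Set.ncard_le_ncard hsub (Set.toFinite _)
    have h2 := ncard_image_coset B D Z hZ (v g)
    have h3 : (0 : ℝ) < Nat.card ↥(B ⊓ D) := by exact_mod_cast Nat.card_pos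
    rw [le_div_iff₀ h3]
    exact_mod_cast (Nat.mul_le_mul_right _ h1).trans h2.le

/-! ### Permutations of a sequence of given type -/

theorem log_factorial_succ (n : ℕ) :
    Real.log ((n + 1).factorial : ℝ) = Real.log ((n : ℝ) + 1) + Real.log (n.factorial : ℝ) := by
  rw [Nat.factorial_succ]
  push_cast
  exact Real.log_mul (by positivity) (by positivity)

/-- A weak form of Stirling's formula. -/
theorem log_factorial_bounds (n : ℕ) :
    0 ≤ Real.log (n.factorial : ℝ) - n * Real.log n + n ∧
      Real.log (n.factorial : ℝ) - n * Real.log n + n ≤ 1 + Real.log n := by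
  induction n with
  | zero => simp
  | succ n ih =>
    rcases Nat.eq_zero_or_pos n with rfl | hn
    · simp
    have hn' : (0 : ℝ) < n := by exact_mod_cast hn
    rw [log_factorial_succ]
    push_cast
    have h1 := Real.log_le_sub_one_of_pos (x := ((n : ℝ) + 1) / n) (by positivity)
    have h2 := Real.log_le_sub_one_of_pos (x := (n : ℝ) / (n + 1)) (by positivity)
    rw [Real.log_div (by positivity) (by positivity)] at h1 h2
    have e1 : ((n : ℝ) + 1) / n - 1 = 1 / n := by field_simp; ring
    have e2 : (n : ℝ) / (n + 1) - 1 = -(1 / (n + 1)) := by field_simp; ring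
    rw [e1] at h1
    rw [e2] at h2
    have h3 : (n : ℝ) * (Real.log (n + 1) - Real.log n) ≤ 1 := by
      calc _ ≤ (n : ℝ) * (1 / n) := mul_le_mul_of_nonneg_left h1 hn'.le
        _ = 1 := by field_simp
    have h4 : (n : ℝ) / (n + 1) ≤ n * (Real.log (n + 1) - Real.log n) := by
      calc (n : ℝ) / (n + 1) = n * (1 / (n + 1)) := by ring
        _ ≤ _ := mul_le_mul_of_nonneg_left (by linarith) hn'.le
    have e3 : (n : ℝ) / (n + 1) = 1 - 1 / (n + 1) := by field_simp; ring
    rw [e3] at h4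
    constructor
    · linarith [ih.1]
    · linarith [ih.2]

theorem tendsto_log_mul_natCast_div (C : ℝ) :
    Tendsto (fun N : ℕ => Real.log (C * N) / N) atTop (𝓝 0) := by
  have h1 : Tendsto (fun N : ℕ => Real.log (N : ℝ) / N) atTop (𝓝 0) := by
    have := (Real.isLittleO_log_id_atTop.tendsto_div_nhds_zero).comp tendsto_natCast_atTop_atTop
    exact this
  rcases eq_or_ne C 0 with rfl | hC
  · simp
  have h2 := (tendsto_const_div_atTop_nhds_zero_nat (Real.log C)).add h1
  rw [add_zero] at h2
  refine h2.congr' ?_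
  filter_upwards [eventually_gt_atTop 0] with N hN
  rw [Real.log_mul hC (by exact_mod_cast hN.ne'), add_div]

/-- The correction `- k log N + k` to `log k!` is additive in `k`, so it cancels in the logarithm of
a multinomial coefficient. -/
theorem tendsto_log_factorial_div {k : ℕ → ℕ} {p : ℝ}
    (hk : Tendsto (fun N : ℕ => (k N : ℝ) / N) atTop (𝓝 p)) :
    Tendsto (fun N : ℕ => (Real.log ((k N).factorial : ℝ) - k N * Real.log N + k N) / N) atTop
      (𝓝 (-Real.negMulLog p)) := by
  have hmain : Tendsto (fun N : ℕ => -Real.negMulLog ((k N : ℝ) / N)) atTop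
      (𝓝 (-Real.negMulLog p)) := ((Real.continuous_negMulLog.tendsto p).comp hk).neg
  have herr : Tendsto (fun N : ℕ =>
      (Real.log ((k N).factorial : ℝ) - k N * Real.log (k N) + k N) / N)
      atTop (𝓝 0) := by
    have hup : Tendsto (fun N : ℕ => 1 / (N : ℝ) + Real.log ((|p| + 1) * N) / N) atTop (𝓝 0) := by
      simpa using tendsto_one_div_atTop_nhds_zero_nat.add (tendsto_log_mul_natCast_div (|p| + 1))
    refine tendsto_of_tendsto_of_tendsto_of_le_of_le' tendsto_const_nhds hup ?_ ?_
    · exact Eventually.of_forall fun N => div_nonneg (log_factorial_bounds _).1 (Nat.cast_nonneg _)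
    · have hev : ∀ᶠ N : ℕ in atTop, (k N : ℝ) / N < |p| + 1 :=
        hk.eventually_lt_const (by linarith [le_abs_self p])
      filter_upwards [hev, eventually_gt_atTop 0] with N h1 h2
      have hN : (1 : ℝ) ≤ N := by exact_mod_cast h2
      have hN0 : (0 : ℝ) < N := by linarith
      rw [← add_div]
      refine div_le_div_of_nonneg_right ((log_factorial_bounds _).2.trans ?_) hN0.le
      have h3 : (1 : ℝ) ≤ (|p| + 1) * N := by nlinarith [abs_nonneg p]
      rcases Nat.eq_zero_or_pos (k N) with h0 | h0
      · rw [h0]; simpa using Real.log_nonneg h3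
      · have : Real.log (k N) ≤ Real.log ((|p| + 1) * N) :=
          Real.log_le_log (by exact_mod_cast h0) ((div_lt_iff₀ hN0).1 h1).le
        linarith
  have := herr.add hmain
  rw [zero_add] at this
  refine this.congr' ?_
  filter_upwards [eventually_gt_atTop 0] with N hN
  have hN0 : (N : ℝ) ≠ 0 := by exact_mod_cast hN.ne'
  rcases Nat.eq_zero_or_pos (k N) with h0 | h0
  · simp [h0]
  · have hk0 : (k N : ℝ) ≠ 0 := by exact_mod_cast h0.ne'
    rw [Real.negMulLog, Real.log_div hk0 hN0]
    field_simp
    ring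

/-- The positions of a sequence over `Ω` in which every `ω` occurs `⌈N * P ω⌉₊` times; the letter
at a position is its first component. -/
abbrev Position {Ω : Type*} (P : Ω → ℝ) (N : ℕ) : Type _ := Σ ω : Ω, Fin ⌈(N : ℝ) * P ω⌉₊

/-- The permutations of the positions that do not change the sequence of the values of `X`. -/
def valueStabilizer {Ω : Type*} (P : Ω → ℝ) (N : ℕ) {V : Type*} (X : Ω → V) :
    Subgroup (Equiv.Perm (Position P N)) where
  carrier := {π | ∀ a, X (π a).1 = X a.1}
  mul_mem' {π ρ} hπ hρ a := (hπ (ρ a)).trans (hρ a)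
  one_mem' _ := rfl
  inv_mem' {π} hπ a := by
    have := hπ (π⁻¹ a)
    rw [show π (π⁻¹ a) = a from π.apply_symm_apply a] at this
    exact this.symm

theorem mem_valueStabilizer {Ω : Type*} {P : Ω → ℝ} {N : ℕ} {V : Type*} {X : Ω → V}
    {π : Equiv.Perm (Position P N)} :
    π ∈ valueStabilizer P N X ↔ ∀ a, X (π a).1 = X a.1 := Iff.rfl

theorem tendsto_sum_ceil_div {Ω : Type*} (P : Ω → ℝ) (hP : ∀ ω, 0 ≤ P ω) (s : Finset Ω) :
    Tendsto (fun N : ℕ => ((∑ ω ∈ s, ⌈(N : ℝ) * P ω⌉₊ : ℕ) : ℝ) / N) atTop (𝓝 (∑ ω ∈ s, P ω)) := by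
  simp only [Nat.cast_sum, Finset.sum_div]
  refine tendsto_finsetSum _ fun ω _ => ?_
  have := (tendsto_nat_ceil_mul_div_atTop (hP ω)).comp
    (tendsto_natCast_atTop_atTop (R := ℝ))
  refine this.congr fun N => ?_
  simp [mul_comm]

/-- The number of sequences of values of `X` that are obtained by permuting the positions grows
like `2 ^ (N * H(X))`. -/
theorem tendsto_logb_card_div_valueStabilizer {Ω : Type*} [Fintype Ω] {P : Ω → ℝ}
    (hP : P ∈ stdSimplex ℝ Ω) {V : Type*} (X : Ω → V) :
    Tendsto (fun N : ℕ => Real.logb 2 ((Nat.card (Equiv.Perm (Position P N)) : ℝ) /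
      Nat.card (valueStabilizer P N X)) / N) atTop (𝓝 (entropy P X)) := by
  classical
  -- pass to a variable with finitely many values
  set Y : Ω → Set.range X := Set.rangeFactorization X with hY
  have hXY : ∀ ω ω', X ω = X ω' ↔ Y ω = Y ω' := fun ω ω' => by
    simp [hY, Set.rangeFactorization, Subtype.ext_iff]
  have hstab : ∀ N, valueStabilizer P N X = valueStabilizer P N Y := fun N => by
    ext π
    simp only [mem_valueStabilizer, hXY]
  rw [entropy_congr P X Y hXY]
  simp only [hstab]
  set m : Set.range X → ℕ → ℕ := fun v N =>
    ∑ ω ∈ Finset.univ.filter (fun ω => Y ω = v), ⌈(N : ℝ) * P ω⌉₊ with hm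
  set M : ℕ → ℕ := fun N => ∑ ω, ⌈(N : ℝ) * P ω⌉₊ with hM
  have hMm : ∀ N, M N = ∑ v, m v N := fun N =>
    (Finset.sum_fiberwise _ _ _).symm
  have hG : ∀ N, Nat.card (Equiv.Perm (Position P N)) = (M N).factorial := fun N => by
    rw [Nat.card_perm, Nat.card_eq_fintype_card, Fintype.card_sigma]
    simp [hM]
  have hS : ∀ N, Nat.card (valueStabilizer P N Y) = ∏ v, (m v N).factorial := fun N => by
    have h1 := DomMulAct.stabilizer_card (fun a : Position P N => Y a.1)
    rw [← Nat.card_eq_fintype_card] at h1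
    have h2 : Nat.card (valueStabilizer P N Y) =
        Nat.card {g : Equiv.Perm (Position P N) //
          (fun a : Position P N => Y a.1) ∘ g = fun a => Y a.1} :=
      Nat.card_congr (Equiv.subtypeEquivRight fun π => by
        rw [mem_valueStabilizer, funext_iff]; rfl)
    rw [h2, h1]
    refine Finset.prod_congr rfl fun v _ => congrArg _ ?_
    rw [Fintype.card_subtype, Finset.card_filter, Fintype.sum_sigma, hm]
    simp only
    rw [Finset.sum_filter]
    refine Finset.sum_congr rfl fun ω _ => ?_
    split_ifs <;> simp
  have hlog : ∀ N : ℕ, Real.logb 2 ((Nat.card (Equiv.Perm (Position P N)) : ℝ) /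
      Nat.card (valueStabilizer P N Y)) / N =
      ((Real.log ((M N).factorial : ℝ) - M N * Real.log N + M N) / N -
        ∑ v, (Real.log ((m v N).factorial : ℝ) - m v N * Real.log N + m v N) / N) / Real.log 2 := by
    intro N
    rw [hG, hS, Real.logb, Nat.cast_prod,
      Real.log_div (by positivity) (Finset.prod_ne_zero_iff.2 fun v _ => by positivity),
      Real.log_prod (fun v _ => by positivity), ← Finset.sum_div, Finset.sum_add_distrib,
      Finset.sum_sub_distrib, ← Finset.sum_mul]
    have : (M N : ℝ) = ∑ v, (m v N : ℝ) := by exact_mod_cast hMm N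
    rw [this]
    ring
  have hprob : ∀ v, probEq P Y v = ∑ ω ∈ Finset.univ.filter (fun ω => Y ω = v), P ω := fun v => by
    rw [probEq_eq_sum_ite, Finset.sum_filter]
  have hent : entropy P Y = (-Real.negMulLog 1 - ∑ v, -Real.negMulLog (probEq P Y v)) /
      Real.log 2 := by
    rw [entropy, finsum_eq_sum_of_fintype]
    rw [Real.negMulLog_one, neg_zero, zero_sub, ← Finset.sum_neg_distrib, Finset.sum_div]
    refine Finset.sum_congr rfl fun v _ => ?_
    rw [Real.negMulLog, Real.logb, one_div, Real.log_inv]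
    ring
  simp only [hlog]
  rw [hent]
  refine Tendsto.div_const (Tendsto.sub (tendsto_log_factorial_div ?_)
    (tendsto_finsetSum _ fun v _ => tendsto_log_factorial_div ?_)) _
  · have := tendsto_sum_ceil_div P hP.1 Finset.univ
    rwa [hP.2] at this
  · rw [hprob]
    exact tendsto_sum_ceil_div P hP.1 _

theorem tendsto_logb_log_card_perm {Ω : Type*} [Fintype Ω] {P : Ω → ℝ}
    (hP : P ∈ stdSimplex ℝ Ω) :
    Tendsto (fun N : ℕ => Real.logb 2 (Real.log (Nat.card (Equiv.Perm (Position P N))) + 1) / N)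
      atTop (𝓝 0) := by
  set M : ℕ → ℕ := fun N => ∑ ω, ⌈(N : ℝ) * P ω⌉₊ with hM
  have hG : ∀ N, Nat.card (Equiv.Perm (Position P N)) = (M N).factorial := fun N => by
    rw [Nat.card_perm, Nat.card_eq_fintype_card, Fintype.card_sigma]
    simp [hM]
  have hlim := tendsto_sum_ceil_div P hP.1 Finset.univ
  rw [hP.2] at hlim
  have hup := ((tendsto_log_mul_natCast_div 3).const_mul 2).div_const (Real.log 2)
  rw [mul_zero, zero_div] at hup
  have hl : 0 < Real.log 2 := Real.log_pos one_lt_two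
  have h0 : ∀ N, 0 ≤ Real.log ((M N).factorial : ℝ) := fun N =>
    Real.log_nonneg (by exact_mod_cast (M N).factorial_pos)
  refine tendsto_of_tendsto_of_tendsto_of_le_of_le' tendsto_const_nhds hup
    (Eventually.of_forall fun N => ?_) ?_
  · rw [hG]
    exact div_nonneg (Real.logb_nonneg one_lt_two (by linarith [h0 N])) (Nat.cast_nonneg _)
  · filter_upwards [hlim.eventually_lt_const one_lt_two, eventually_gt_atTop 0] with N h1 h2
    have hN : (1 : ℝ) ≤ N := by exact_mod_cast h2
    have hMN : (M N : ℝ) < 2 * N := (div_lt_iff₀ (by linarith)).1 h1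
    have h3 : Real.log ((M N).factorial : ℝ) ≤ (M N : ℝ) ^ 2 := by
      have h4 : Real.log ((M N).factorial : ℝ) ≤ Real.log ((M N : ℝ) ^ M N) :=
        Real.log_le_log (by positivity) (by exact_mod_cast Nat.factorial_le_pow (M N))
      rw [Real.log_pow] at h4
      refine h4.trans ?_
      rw [sq]
      exact mul_le_mul_of_nonneg_left (Real.log_le_self (by positivity)) (by positivity)
    have h5 : Real.log ((M N).factorial : ℝ) + 1 ≤ (3 * N : ℝ) ^ 2 := by
      have : (M N : ℝ) ^ 2 ≤ (2 * N) ^ 2 := pow_le_pow_left₀ (by positivity) hMN.le 2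
      nlinarith
    have h6 : Real.log (Real.log ((M N).factorial : ℝ) + 1) ≤ 2 * Real.log (3 * N) := by
      have := Real.log_le_log (by linarith [h0 N]) h5
      rwa [Real.log_pow] at this
    rw [hG, Real.logb, div_right_comm, ← mul_div_assoc]
    gcongr

/-! ### The Ahlswede–Körner extension of an entropic polymatroid -/

/-- Scaling an entropic polymatroid down keeps it entropic, up to an error that is the same on all
nonempty sets. -/
theorem IsEntropic.exists_scale {E : Type*} {h : Set E → ℝ} (hh : IsEntropic h) {t : ℝ}
    (ht : 0 < t) (ht' : t ≤ 1) : ∃ g : Set E → ℝ, IsEntropic g ∧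
      ∀ S : Set E, S.Nonempty → g S = Real.binEntropy t / Real.log 2 + t * h S := by
  obtain ⟨Ω, _, P, V, X, hP, hX⟩ := hh
  refine ⟨_, ⟨Option Ω, inferInstance, mixNone P t, fun i => Option (V i),
    fun i => Option.map (X i), mixNone_mem_stdSimplex hP ht.le ht', fun S => rfl⟩, fun S hS => ?_⟩
  rw [hX, ← entropy_mixNone hP ht]
  obtain ⟨j, hj⟩ := hS
  refine entropy_congr _ _ _ fun o o' => ?_
  cases o with
  | none =>
    cases o' with
    | none => simp
    | some ω' =>
      simp only [Option.map_none, Option.map_some, reduceCtorEq, iff_false]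
      exact fun H => by simpa using congrFun H ⟨j, hj⟩
  | some ω =>
    cases o' with
    | none =>
      simp only [Option.map_none, Option.map_some, reduceCtorEq, iff_false]
      exact fun H => by simpa using congrFun H ⟨j, hj⟩
    | some ω' => simp [funext_iff]

/-- The logarithm of the index of the subgroup `D`: the entropy of a uniformly distributed left
coset of `D`. -/
noncomputable def logIndex {G : Type*} [Group G] (D : Subgroup G) : ℝ :=
  Real.logb 2 ((Nat.card G : ℝ) / Nat.card D)

theorem logIndex_sub_logIndex {G : Type*} [Group G] [Finite G] (C D : Subgroup G) :
    logIndex C - logIndex D = Real.logb 2 ((Nat.card D : ℝ) / Nat.card C) := by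
  have hpos : ∀ D : Subgroup G, (Nat.card D : ℝ) ≠ 0 := fun D => by
    exact_mod_cast Nat.card_pos.ne'
  have hG : (Nat.card G : ℝ) ≠ 0 := by exact_mod_cast Nat.card_pos.ne'
  rw [logIndex, logIndex, Real.logb_div hG (hpos _), Real.logb_div hG (hpos _),
    Real.logb_div (hpos _) (hpos _)]
  ring

/-- The Ahlswede–Körner extension when the variables are the cosets of a uniformly distributed
element of a finite group `G`. The new element `none` is the covering variable; the last term in
the bound for its rank is the price for covering all of `G`. -/
theorem exists_entropic_extension_cosets {E : Type*} {G : Type} [Group G] [Fintype G]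
    (Γ : E → Subgroup G) (A B : Set E) :
    ∃ k : Set (Option E) → ℝ, IsEntropic k ∧
      (∀ S, k (some '' S) = logIndex (⨅ i ∈ S, Γ i)) ∧
      k {none} ≤ logIndex (⨅ i ∈ A, Γ i) + logIndex (⨅ i ∈ B, Γ i) -
        logIndex (⨅ i ∈ A ∪ B, Γ i) + Real.logb 2 (Real.log (Nat.card G) + 1) ∧
      k (insert none (some '' A)) ≤ logIndex (⨅ i ∈ A, Γ i) ∧
      ∀ S ⊆ A, k (insert none (some '' S)) ≤
        k {none} + (logIndex (⨅ i ∈ S ∪ B, Γ i) - logIndex (⨅ i ∈ B, Γ i)) := by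
  classical
  obtain ⟨w, hw, hcard, hcount⟩ :=
    exists_covering_variable (⨅ i ∈ A, Γ i) (⨅ i ∈ B, Γ i)
  set U : G → ℝ := fun _ => (Nat.card G : ℝ)⁻¹
  have hU : U ∈ stdSimplex ℝ G := uniform_mem_stdSimplex G
  have hpos : ∀ D : Subgroup G, (0 : ℝ) < Nat.card D := fun D => by exact_mod_cast Nat.card_pos
  have hG : (0 : ℝ) < Nat.card G := by exact_mod_cast Nat.card_pos
  let V : Option E → Type := fun o => o.elim G fun i => G ⧸ Γ i
  let R : ∀ o : Option E, G → V o := fun o => match o with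
    | none => w
    | some i => fun g => (g : G ⧸ Γ i)
  have hR : ∀ (S : Set E) (g g' : G), (∀ i ∈ S, R (some i) g = R (some i) g') ↔
      g⁻¹ * g' ∈ ⨅ i ∈ S, Γ i := fun S g g' => by
    simp only [Subgroup.mem_iInf]
    exact forall₂_congr fun i _ => QuotientGroup.eq
  have hsome : ∀ S : Set E, entropy U (fun g (j : ↥(some '' S)) => R j g) =
      logIndex (⨅ i ∈ S, Γ i) := fun S => by
    refine entropy_coset (⨅ i ∈ S, Γ i) _ fun g g' => ?_
    rw [← hR, funext_iff]
    simp
  have hnone : entropy U (fun g (j : ↥({none} : Set (Option E))) => R j g) = entropy U w := by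
    refine entropy_congr _ _ _ fun g g' => ?_
    rw [funext_iff]
    simp only [Subtype.forall, Set.mem_singleton_iff, forall_eq]
    rfl
  have hpair : ∀ S : Set E, ∀ g g' : G,
      (fun (j : ↥(insert none (some '' S))) => R j g) =
        (fun (j : ↥(insert none (some '' S))) => R j g') ↔
      (∀ i ∈ S, R (some i) g = R (some i) g') ∧ w g = w g' := fun S g g' => by
    rw [funext_iff]
    simp only [Subtype.forall, Set.mem_insert_iff, forall_eq_or_imp, Set.forall_mem_image]
    exact and_comm
  refine ⟨_, ⟨G, inferInstance, U, V, R, hU, fun S => rfl⟩, hsome, ?_, ?_, fun S hS => ?_⟩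
  · rw [hnone]
    have hlog0 : 0 ≤ Real.log (Nat.card G) := Real.log_natCast_nonneg _
    have hl : (0 : ℝ) < Real.log (Nat.card G) + 1 := by linarith
    have hQ := div_pos (mul_pos hG (hpos ((⨅ i ∈ B, Γ i) ⊓ ⨅ i ∈ A, Γ i)))
      (mul_pos (hpos (⨅ i ∈ A, Γ i)) (hpos (⨅ i ∈ B, Γ i)))
    refine (entropy_le_logb_ncard hU w (mul_pos hQ hl) hcard).trans (le_of_eq ?_)
    rw [Real.logb_mul hQ.ne' hl.ne', add_sub_assoc, logIndex_sub_logIndex, logIndex,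
      Set.union_comm, iInf_union, ← Real.logb_mul (div_pos hG (hpos _)).ne'
      (div_pos (hpos _) (hpos _)).ne', div_mul_div_comm]
  · rw [← hsome A]
    refine entropy_le_of_imp hU.1 fun g g' H => (hpair A g g').2 ?_
    have H' : ∀ i ∈ A, R (some i) g = R (some i) g' := fun i hi =>
      congrFun H ⟨some i, i, hi, rfl⟩
    exact ⟨H', hw _ _ ((hR A g g').1 H')⟩
  · rw [hnone]
    have hZ := fun g g' : G => QuotientGroup.eq (s := ⨅ i ∈ S, Γ i) (a := g) (b := g')
    have hZle := entropy_pair_le hU _ w (div_pos (hpos _) (hpos _))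
      (hcount (⨅ i ∈ S, Γ i) (biInf_mono fun _ hi => hS hi) _ hZ)
    refine le_trans (le_of_eq (entropy_congr _ _ _ fun g g' => ?_)) (hZle.trans (le_of_eq ?_))
    · rw [hpair, Prod.mk.injEq, hZ, hR]
    · rw [logIndex_sub_logIndex, Set.union_comm, iInf_union]

theorem valueStabilizer_tuple {Ω E : Type*} (P : Ω → ℝ) (N : ℕ) {V : E → Type*}
    (X : ∀ i, Ω → V i) (S : Set E) :
    valueStabilizer P N (fun ω (i : S) => X i ω) = ⨅ i ∈ S, valueStabilizer P N (X i) := by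
  ext π
  simp only [Subgroup.mem_iInf, mem_valueStabilizer, funext_iff, Subtype.forall]
  exact ⟨fun H i hi a => H a i hi, fun H a i hi => H i hi a⟩

theorem tendsto_binEntropy_inv : Tendsto (fun N : ℕ => Real.binEntropy (1 / (N : ℝ)) / Real.log 2)
    atTop (𝓝 0) := by
  have := ((Real.binEntropy_continuous.tendsto 0).comp
    tendsto_one_div_atTop_nhds_zero_nat).div_const (Real.log 2)
  simpa using this

/-- The inequalities that make the new element `none` an Ahlswede–Körner extension with respect to
`A` and `B`: it is spanned by `A`, its rank is at most the mutual information of `A` and `B`, and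
it reduces the rank of each subset of `A` at least as much as `B` does. -/
structure IsAhlswedeKorner {E : Type*} (A B : Set E) (g : Set (Option E) → ℝ) : Prop where
  rank_le : g {none} ≤ g (some '' A) + g (some '' B) - g (some '' (A ∪ B))
  span : g (insert none (some '' A)) ≤ g (some '' A)
  conditional : ∀ S ⊆ A,
    g (insert none (some '' S)) ≤ g {none} + (g (some '' (S ∪ B)) - g (some '' B))

theorem isClosed_isAhlswedeKorner {E : Type*} (A B : Set E) :
    IsClosed {g : Set (Option E) → ℝ | IsAhlswedeKorner A B g} := by
  have hc : ∀ S : Set (Option E), Continuous fun g : Set (Option E) → ℝ => g S := continuous_apply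
  have : {g : Set (Option E) → ℝ | IsAhlswedeKorner A B g} =
      {g | g {none} ≤ g (some '' A) + g (some '' B) - g (some '' (A ∪ B))} ∩
      ({g | g (insert none (some '' A)) ≤ g (some '' A)} ∩
      ⋂ S : Set E, ⋂ _ : S ⊆ A,
        {g | g (insert none (some '' S)) ≤ g {none} + (g (some '' (S ∪ B)) - g (some '' B))}) := by
    ext g
    simp only [Set.mem_inter_iff, Set.mem_iInter, Set.mem_ofPred_eq]
    exact ⟨fun h => ⟨h.1, h.2, h.3⟩, fun h => ⟨h.1, h.2.1, h.2.2⟩⟩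
  rw [this]
  refine IsClosed.inter (isClosed_le (hc _) (((hc _).add (hc _)).sub (hc _)))
    (IsClosed.inter (isClosed_le (hc _) (hc _)) (isClosed_iInter fun S => isClosed_iInter fun _ =>
      isClosed_le (hc _) ((hc _).add ((hc _).sub (hc _)))))

theorem IsPolymatroid.nonneg {E : Type*} {f : Set E → ℝ} (hf : IsPolymatroid f) (S : Set E) :
    0 ≤ f S := hf.empty ▸ hf.mono _ _ (Set.empty_subset S)

theorem isClosed_isPolymatroid {E : Type*} : IsClosed {f : Set E → ℝ | IsPolymatroid f} := by
  have hc : ∀ S : Set E, Continuous fun g : Set E → ℝ => g S := continuous_apply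
  have : {f : Set E → ℝ | IsPolymatroid f} = {f | f ∅ = 0} ∩
      ((⋂ A : Set E, ⋂ B : Set E, ⋂ _ : A ⊆ B, {f | f A ≤ f B}) ∩
      ⋂ A : Set E, ⋂ B : Set E, {f | f (A ∪ B) + f (A ∩ B) ≤ f A + f B}) := by
    ext g
    simp only [Set.mem_inter_iff, Set.mem_iInter, Set.mem_ofPred_eq]
    exact ⟨fun h => ⟨h.1, h.2, h.3⟩, fun h => ⟨h.1, h.2.1, h.2.2⟩⟩
  rw [this]
  exact IsClosed.inter (isClosed_eq (hc _) continuous_const)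
    (IsClosed.inter
      (isClosed_iInter fun A => isClosed_iInter fun B => isClosed_iInter fun _ =>
        isClosed_le (hc _) (hc _))
      (isClosed_iInter fun A => isClosed_iInter fun B =>
        isClosed_le ((hc _).add (hc _)) ((hc _).add (hc _))))

theorem isPolymatroid_of_mem_closure {E : Type*} {f : Set E → ℝ}
    (hf : f ∈ closure {h : Set E → ℝ | IsEntropic h}) : IsPolymatroid f :=
  closure_minimal (fun _ h => IsEntropic.isPolymatroid h) isClosed_isPolymatroid hf

/-- Tychonoff's theorem, for an ultrafilter on a family of functions. -/
theorem exists_tendsto_of_eventually_mem_Icc {α ι : Type*} (U : Ultrafilter α) (g : α → ι → ℝ)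
    (h : ∀ i, ∃ a b : ℝ, ∀ᶠ x in U, g x i ∈ Set.Icc a b) :
    ∃ l : ι → ℝ, Tendsto g U (𝓝 l) := by
  have : ∀ i, ∃ l : ℝ, Tendsto (fun x => g x i) U (𝓝 l) := fun i => by
    obtain ⟨a, b, hab⟩ := h i
    obtain ⟨l, -, hl⟩ := (isCompact_Icc (a := a) (b := b)).ultrafilter_le_nhds'
      (U.map fun x => g x i) hab
    exact ⟨l, hl⟩
  choose l hl using this
  exact ⟨l, tendsto_pi_nhds.2 hl⟩

/-- Along an ultrafilter, polymatroids on `Option E` converge as soon as their restrictions to `E`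
converge and the rank of the new element stays bounded. -/
theorem exists_tendsto_of_tendsto_some {α E : Type*} (U : Ultrafilter α)
    {g : α → Set (Option E) → ℝ} (hg : ∀ᶠ x in U, IsPolymatroid (g x)) {f : Set E → ℝ}
    (hf : ∀ S, Tendsto (fun x => g x (some '' S)) U (𝓝 (f S))) {c : ℝ}
    (hc : ∀ᶠ x in U, g x {none} ≤ c) : ∃ l, Tendsto g U (𝓝 l) := by
  refine exists_tendsto_of_eventually_mem_Icc U g fun S => ⟨0, f (some ⁻¹' S) + 1 + c, ?_⟩
  filter_upwards [hg, hc, (hf (some ⁻¹' S)).eventually_lt_const (lt_add_one _)] with x h1 h2 h3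
  refine ⟨h1.nonneg S, ?_⟩
  have hsub : S ⊆ some '' (some ⁻¹' S) ∪ {none} := by
    intro o ho
    cases o with
    | none => exact .inr rfl
    | some i => exact .inl ⟨i, ho, rfl⟩
  have h4 := h1.mono _ _ hsub
  have h5 := h1.submodular (some '' (some ⁻¹' S)) {none}
  have h6 := h1.nonneg (some '' (some ⁻¹' S) ∩ {none})
  linarith

theorem IsEntropic.exists_isAhlswedeKorner {E : Type*} {h : Set E → ℝ} (hh : IsEntropic h)
    (A B : Set E) : ∃ g : Set (Option E) → ℝ, g ∈ closure {k | IsEntropic k} ∧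
      IsAhlswedeKorner A B g ∧ ∀ S, g (some '' S) = h S := by
  classical
  have hh' := hh
  obtain ⟨Ω, _, P, V, X, hP, hX⟩ := hh'
  set c : ℕ → Set E → ℝ := fun N S => logIndex (⨅ i ∈ S, valueStabilizer P N (X i)) / N with hc
  set δ : ℕ → ℝ := fun N => Real.binEntropy (1 / (N : ℝ)) / Real.log 2 with hδ
  set ε : ℕ → ℝ := fun N =>
    Real.logb 2 (Real.log (Nat.card (Equiv.Perm (Position P N))) + 1) / N with hε
  have hclim : ∀ S, Tendsto (fun N => c N S) atTop (𝓝 (h S)) := fun S => by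
    rw [hX S]
    refine (tendsto_logb_card_div_valueStabilizer hP _).congr fun N => ?_
    simp only [hc, logIndex, valueStabilizer_tuple]
  have hδlim : Tendsto δ atTop (𝓝 0) := tendsto_binEntropy_inv
  have hεlim : Tendsto ε atTop (𝓝 0) := tendsto_logb_log_card_perm hP
  -- for each `N`, the extension by cosets, scaled down by `N`
  have hex : ∀ N : ℕ, ∃ g : Set (Option E) → ℝ, 0 < N → IsEntropic g ∧
      (∀ S : Set E, S.Nonempty → g (some '' S) = δ N + c N S) ∧
      g {none} ≤ δ N + (c N A + c N B - c N (A ∪ B) + ε N) ∧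
      g (insert none (some '' A)) ≤ δ N + c N A ∧
      ∀ S ⊆ A, g (insert none (some '' S)) ≤ g {none} + (c N (S ∪ B) - c N B) := by
    intro N
    obtain ⟨k, hk, hk1, hk2, hk3, hk4⟩ :=
      exists_entropic_extension_cosets (fun i => valueStabilizer P N (X i)) A B
    rcases Nat.eq_zero_or_pos N with rfl | hN
    · exact ⟨k, fun h => absurd h (lt_irrefl 0)⟩
    have hN1 : (1 : ℝ) ≤ N := by exact_mod_cast hN
    have hN0 : (0 : ℝ) < 1 / N := by positivity
    obtain ⟨g, hg, hgk⟩ := hk.exists_scale hN0 ((div_le_one (by linarith)).2 hN1)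
    refine ⟨g, fun _ => ⟨hg, fun S hS => ?_, ?_, ?_, fun S hS => ?_⟩⟩
    · rw [hgk _ (hS.image _), hk1]
      simp only [hδ, hc]
      ring
    · rw [hgk _ (Set.singleton_nonempty _)]
      have := mul_le_mul_of_nonneg_left hk2 hN0.le
      simp only [hδ, hc, hε]
      refine (add_le_add_right this _).trans (le_of_eq ?_)
      ring
    · rw [hgk _ (Set.insert_nonempty _ _)]
      have := mul_le_mul_of_nonneg_left hk3 hN0.le
      simp only [hδ, hc]
      refine (add_le_add_right this _).trans (le_of_eq ?_)
      ring
    · rw [hgk _ (Set.insert_nonempty _ _), hgk _ (Set.singleton_nonempty _)]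
      have := mul_le_mul_of_nonneg_left (hk4 S hS) hN0.le
      simp only [hc]
      refine (add_le_add_right this _).trans (le_of_eq ?_)
      ring
  choose g hg using hex
  set U : Ultrafilter ℕ := hyperfilter ℕ
  have hU : (U : Filter ℕ) ≤ atTop := Nat.hyperfilter_le_atTop
  have hgent : ∀ᶠ N in U, IsEntropic (g N) :=
    hU ((eventually_gt_atTop 0).mono fun N hN => (hg N hN).1)
  have hsome : ∀ S, Tendsto (fun N => g N (some '' S)) U (𝓝 (h S)) := fun S => by
    -- scaling adds the error `δ N` on nonempty sets only
    rcases S.eq_empty_or_nonempty with rfl | hS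
    · rw [hh.isPolymatroid.empty]
      refine tendsto_const_nhds.congr' (hgent.mono fun N hN => ?_)
      rw [Set.image_empty]
      exact hN.isPolymatroid.empty.symm
    · have := (hδlim.add (hclim S)).mono_left hU
      rw [zero_add] at this
      refine this.congr' (hU ((eventually_gt_atTop 0).mono fun N hN => ?_))
      exact ((hg N hN).2.1 S hS).symm
  have hbound : Tendsto (fun N => δ N + (c N A + c N B - c N (A ∪ B) + ε N)) U
      (𝓝 (0 + (h A + h B - h (A ∪ B) + 0))) :=
    (hδlim.add ((((hclim A).add (hclim B)).sub (hclim (A ∪ B))).add hεlim)).mono_left hU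
  have hle : ∀ᶠ N in U, g N {none} ≤ δ N + (c N A + c N B - c N (A ∪ B) + ε N) :=
    hU ((eventually_gt_atTop 0).mono fun N hN => (hg N hN).2.2.1)
  obtain ⟨l, hl⟩ := exists_tendsto_of_tendsto_some U (hgent.mono fun N hN => hN.isPolymatroid)
    hsome (hle.mp ((hbound.eventually_lt_const (lt_add_one _)).mono fun N h1 h2 =>
      h2.trans h1.le))
  have hl' : ∀ S, Tendsto (fun N => g N S) U (𝓝 (l S)) := tendsto_pi_nhds.1 hl
  have hls : ∀ S, l (some '' S) = h S := fun S => tendsto_nhds_unique (hl' _) (hsome S)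
  refine ⟨l, mem_closure_of_tendsto hl hgent, ⟨?_, ?_, fun S hS => ?_⟩, hls⟩
  · rw [hls, hls, hls]
    simpa using le_of_tendsto_of_tendsto (hl' _) hbound hle
  · rw [hls]
    have := (hδlim.add (hclim A)).mono_left hU
    rw [zero_add] at this
    exact le_of_tendsto_of_tendsto (hl' _) this
      (hU ((eventually_gt_atTop 0).mono fun N hN => (hg N hN).2.2.2.1))
  · rw [hls, hls]
    exact le_of_tendsto_of_tendsto (hl' _)
      ((hl' _).add (((hclim (S ∪ B)).sub (hclim B)).mono_left hU))
      (hU ((eventually_gt_atTop 0).mono fun N hN => (hg N hN).2.2.2.2 S hS))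

/-! ### The Ahlswede–Körner extension of an almost entropic polymatroid -/

theorem exists_isAhlswedeKorner_of_mem_closure {E : Type*} {f : Set E → ℝ}
    (hf : f ∈ closure {h : Set E → ℝ | IsEntropic h}) (A B : Set E) :
    ∃ g : Set (Option E) → ℝ, g ∈ closure {k | IsEntropic k} ∧
      IsAhlswedeKorner A B g ∧ ∀ S, g (some '' S) = f S := by
  obtain ⟨U, hU, hUf⟩ := mem_closure_iff_ultrafilter.1 hf
  have hex : ∀ h : Set E → ℝ, ∃ g : Set (Option E) → ℝ, IsEntropic h →
      g ∈ closure {k | IsEntropic k} ∧ IsAhlswedeKorner A B g ∧ ∀ S, g (some '' S) = h S := by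
    intro h
    by_cases hh : IsEntropic h
    · obtain ⟨g, hg⟩ := hh.exists_isAhlswedeKorner A B
      exact ⟨g, fun _ => hg⟩
    · exact ⟨0, fun h => absurd h hh⟩
  choose g hg using hex
  have hent : ∀ᶠ h in (U : Filter (Set E → ℝ)), IsEntropic h := hU
  have hsome : ∀ S, Tendsto (fun h => g h (some '' S)) U (𝓝 (f S)) := fun S => by
    have : Tendsto (fun h : Set E → ℝ => h S) U (𝓝 (f S)) :=
      ((continuous_apply S).tendsto f).mono_left hUf
    exact this.congr' (hent.mono fun h hh => ((hg h hh).2.2 S).symm)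
  have hbound := ((hsome A).add (hsome B)).sub (hsome (A ∪ B))
  obtain ⟨l, hl⟩ := exists_tendsto_of_tendsto_some U
    (hent.mono fun h hh => isPolymatroid_of_mem_closure (hg h hh).1) hsome
    (hent.mp ((hbound.eventually_lt_const (lt_add_one _)).mono fun h h1 h2 =>
      (hg h h2).2.1.rank_le.trans h1.le))
  refine ⟨l, isClosed_closure.mem_of_tendsto hl (hent.mono fun h hh => (hg h hh).1),
    (isClosed_isAhlswedeKorner A B).mem_of_tendsto hl (hent.mono fun h hh => (hg h hh).2.1),
    fun S => tendsto_nhds_unique (tendsto_pi_nhds.1 hl _) (hsome S)⟩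

/-- The largest polymatroid of finite type below `g`: it agrees with `g` on finite sets. -/
noncomputable def finiteTypePart {E : Type*} (g : Set E → ℝ) (S : Set E) : ℝ :=
  ⨆ F : Finset E, g (S ∩ F)

theorem IsPolymatroid.tendsto_finiteTypePart {E : Type*} {g : Set E → ℝ} (hg : IsPolymatroid g)
    (S : Set E) : Tendsto (fun F : Finset E => g (S ∩ F)) atTop (𝓝 (finiteTypePart g S)) := by
  refine tendsto_atTop_ciSup (fun F F' h => hg.mono _ _ ?_) ⟨g S, ?_⟩
  · exact Set.inter_subset_inter_right S (by exact_mod_cast h)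
  · rintro _ ⟨F, rfl⟩
    exact hg.mono _ _ Set.inter_subset_left

theorem IsPolymatroid.finiteTypePart_of_finite {E : Type*} {g : Set E → ℝ} (hg : IsPolymatroid g)
    {S : Set E} (hS : S.Finite) : finiteTypePart g S = g S := by
  refine tendsto_nhds_unique (hg.tendsto_finiteTypePart S) (tendsto_const_nhds.congr' ?_)
  filter_upwards [eventually_ge_atTop hS.toFinset] with F hF
  rw [Set.inter_eq_left.2 fun i hi => hF (hS.mem_toFinset.2 hi)]

theorem isAlmostEntropic_finiteTypePart {E : Type*} {g : Set E → ℝ}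
    (hg : g ∈ closure {h : Set E → ℝ | IsEntropic h}) : IsAlmostEntropic (finiteTypePart g) := by
  have hpoly := isPolymatroid_of_mem_closure hg
  have hmem : finiteTypePart g ∈ closure {h : Set E → ℝ | IsEntropic h} := by
    refine isClosed_closure.mem_of_tendsto (f := fun (F : Finset E) S => g (S ∩ F)) (b := atTop)
      (tendsto_pi_nhds.2 hpoly.tendsto_finiteTypePart) (Eventually.of_forall fun F => ?_)
    exact map_mem_closure (f := fun (h : Set E → ℝ) S => h (S ∩ F))
      (continuous_pi fun S => continuous_apply _) hg fun h hh => IsEntropic.inter hh _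
  refine ⟨isPolymatroid_of_mem_closure hmem, fun S => ⟨?_, fun b hb => ?_⟩, hmem⟩
  · rintro _ ⟨F, hFS, -, rfl⟩
    exact (isPolymatroid_of_mem_closure hmem).mono _ _ hFS
  · refine ciSup_le fun F => ?_
    have hfin : (S ∩ F : Set E).Finite := F.finite_toSet.inter_of_right S
    exact hb ⟨S ∩ F, Set.inter_subset_left, hfin, (hpoly.finiteTypePart_of_finite hfin).symm⟩

/-- The Ahlswede–Körner lemma for almost entropic polymatroids. -/
theorem IsAlmostEntropic.exists_isAhlswedeKorner {E : Type*} {f : Set E → ℝ}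
    (hf : IsAlmostEntropic f) {A B : Set E} (hA : A.Finite) (hB : B.Finite) :
    ∃ g : Set (Option E) → ℝ, IsAlmostEntropic g ∧ IsAhlswedeKorner A B g ∧
      ∀ S, g (some '' S) = f S := by
  obtain ⟨g, hg, hAK, hgf⟩ := exists_isAhlswedeKorner_of_mem_closure hf.mem_closure A B
  have hpoly := isPolymatroid_of_mem_closure hg
  have hfin : ∀ {S}, S.Finite → finiteTypePart g S = g S := hpoly.finiteTypePart_of_finite
  have hae := isAlmostEntropic_finiteTypePart hg
  refine ⟨finiteTypePart g, hae, ⟨?_, ?_, fun S hS => ?_⟩, fun S => ?_⟩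
  · rw [hfin (Set.finite_singleton _), hfin (hA.image _), hfin (hB.image _),
      hfin ((hA.union hB).image _)]
    exact hAK.rank_le
  · rw [hfin ((hA.image _).insert _), hfin (hA.image _)]
    exact hAK.span
  · have hSf := hA.subset hS
    rw [hfin ((hSf.image _).insert _), hfin (Set.finite_singleton _),
      hfin ((hSf.union hB).image _), hfin (hB.image _)]
    exact hAK.conditional S hS
  · have hset : {r | ∃ F : Set (Option E), F ⊆ some '' S ∧ F.Finite ∧ r = finiteTypePart g F} =
        {r | ∃ F : Set E, F ⊆ S ∧ F.Finite ∧ r = f F} := by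
      refine Set.ext fun r => ⟨?_, ?_⟩
      · rintro ⟨F, hF, hFf, rfl⟩
        obtain ⟨F', hF', rfl⟩ := Set.subset_image_iff.1 hF
        exact ⟨F', hF', hFf.of_finite_image (Option.some_injective _).injOn, by rw [hfin hFf, hgf]⟩
      · rintro ⟨F, hF, hFf, rfl⟩
        exact ⟨some '' F, Set.image_mono hF, hFf.image _, by rw [hfin (hFf.image _), hgf]⟩
    exact (hset ▸ hae.finiteType (some '' S)).unique (hf.finiteType S)

/-! ### Desargues configurations -/

/-- A line that meets `S` in two independent points lies in the span of `S`. -/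
theorem IsPolymatroid.union_line_le {E : Type*} {f : Set E → ℝ} (hf : IsPolymatroid f)
    {S T : Set E} (hT : f T ≤ 2) {p q : E} (hpq : 2 ≤ f {p, q}) (hpS : p ∈ S) (hqS : q ∈ S)
    (hpT : p ∈ T) (hqT : q ∈ T) : f (S ∪ T) ≤ f S := by
  have h1 := hf.submodular S T
  have h2 : f {p, q} ≤ f (S ∩ T) := hf.mono _ _
    (Set.insert_subset ⟨hpS, hpT⟩ (Set.singleton_subset_iff.2 ⟨hqS, hqT⟩))
  linarith

theorem IsPolymatroid.union_le {E : Type*} {f : Set E → ℝ} (hf : IsPolymatroid f) (S T : Set E) :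
    f (S ∪ T) ≤ f S + f T := by
  linarith [hf.submodular S T, hf.nonneg (S ∩ T)]

theorem IsPolymatroid.insert_le {E : Type*} {f : Set E → ℝ} (hf : IsPolymatroid f) (p : E)
    (S : Set E) : f (insert p S) ≤ f {p} + f S :=
  hf.union_le {p} S

/-- The inequality `f (S ∩ T) ≤ f S + f T - f (S ∪ T)`, with estimates for all four terms. -/
theorem IsPolymatroid.le_of_subset_inter {E : Type*} {f : Set E → ℝ} (hf : IsPolymatroid f)
    {Q R S T : Set E} (hQ : Q ⊆ S ∩ T) (hR : R ⊆ S ∪ T) : f R + f Q ≤ f S + f T := by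
  linarith [hf.submodular S T, hf.mono _ _ hQ, hf.mono _ _ hR]

/-- The points `x₁`, `x₂` and every point `z` of the line `p₁p₂` lie in the plane of the triangle
`p₁p₂p₃`. -/
theorem IsPolymatroid.triangle_le {E : Type*} {f : Set E → ℝ} (hf : IsPolymatroid f)
    {p₁ p₂ p₃ x₁ x₂ z : E} (h₁ : f {p₁} = 1) (h₁₂ : f {p₁, p₂} = 2) (h₁₃ : f {p₁, p₃} = 2)
    (h₂₃ : f {p₂, p₃} = 2)
    (hx₁ : f {p₂, p₃, x₁} ≤ 2) (hx₂ : f {p₁, p₃, x₂} ≤ 2) (hz : f {p₁, p₂, z} ≤ 2) :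
    f ({p₁, p₂, p₃} ∪ {p₂, p₃, x₁} ∪ {p₁, p₃, x₂} ∪ {p₁, p₂, z}) ≤ 3 := by
  have h0 := hf.insert_le p₁ {p₂, p₃}
  have h1 := hf.union_line_le (S := {p₁, p₂, p₃}) hx₁ h₂₃.ge
    (by simp) (by simp) (by simp) (by simp)
  have h2 := hf.union_line_le (S := {p₁, p₂, p₃} ∪ {p₂, p₃, x₁}) hx₂ h₁₃.ge
    (by simp) (by simp) (by simp) (by simp)
  have h3 := hf.union_line_le (S := {p₁, p₂, p₃} ∪ {p₂, p₃, x₁} ∪ {p₁, p₃, x₂}) hz h₁₂.ge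
    (by simp) (by simp) (by simp) (by simp)
  linarith

namespace IsDesarguesConfiguration

variable {E : Type*} {f : Set E → ℝ} {O a₁ a₂ a₃ b₁ b₂ b₃ x₁ x₂ : E}

theorem map {E' : Type*} (hC : IsDesarguesConfiguration f O a₁ a₂ a₃ b₁ b₂ b₃ x₁ x₂)
    {g : Set E' → ℝ} (ι : E ↪ E') (hg : ∀ S : Set E, g (ι '' S) = f S) :
    IsDesarguesConfiguration g (ι O) (ι a₁) (ι a₂) (ι a₃) (ι b₁) (ι b₂) (ι b₃) (ι x₁) (ι x₂) := by
  have h1 : ∀ p, g {ι p} = f {p} := fun p => by rw [← hg, Set.image_singleton]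
  have h2 : ∀ p q, g {ι p, ι q} = f {p, q} := fun p q => by rw [← hg, Set.image_pair]
  have h3 : ∀ p q r, g {ι p, ι q, ι r} = f {p, q, r} := fun p q r => by
    rw [← hg, Set.image_insert_eq, Set.image_pair]
  have hset : ({ι O, ι a₁, ι a₂, ι a₃, ι b₁, ι b₂, ι b₃, ι x₁, ι x₂} : Set E') =
      ι '' {O, a₁, a₂, a₃, b₁, b₂, b₃, x₁, x₂} := by
    simp only [Set.image_insert_eq, Set.image_singleton]
  refine ⟨by simpa using hC.distinct.map ι.injective, ?_, ?_, by rw [h3, hC.perspective₁],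
    by rw [h3, hC.perspective₂], by rw [h3, hC.perspective₃], by rw [h3, hC.a_x₁],
    by rw [h3, hC.b_x₁], by rw [h3, hC.a_x₂], by rw [h3, hC.b_x₂], ?_⟩
  · rw [hset, Set.forall_mem_image]
    intro p hp
    rw [h1, hC.rank_point p hp]
  · rw [hset, Set.forall_mem_image]
    intro p hp
    rw [Set.forall_mem_image]
    intro q hq hpq
    rw [h2, hC.rank_pair p hp q hq fun h => hpq (congrArg ι h)]
  · rw [← hC.rank_four, ← hg]
    simp only [Set.image_insert_eq, Set.image_singleton]

theorem rank_pairs (hC : IsDesarguesConfiguration f O a₁ a₂ a₃ b₁ b₂ b₃ x₁ x₂) :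
    (f {O, a₁} = 2 ∧ f {O, a₂} = 2) ∧ (f {O, b₁} = 2 ∧ f {O, b₂} = 2 ∧ f {O, b₃} = 2) ∧
      (f {a₁, a₂} = 2 ∧ f {a₁, a₃} = 2 ∧ f {a₂, a₃} = 2) ∧
      (f {b₁, b₂} = 2 ∧ f {b₁, b₃} = 2 ∧ f {b₂, b₃} = 2) ∧
      f {a₁, b₁} = 2 ∧ f {a₁, x₂} = 2 ∧ f {x₁, x₂} = 2 := by
  have hd := hC.distinct
  simp only [List.nodup_cons, List.mem_cons, List.not_mem_nil, not_or, or_false] at hd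
  have hp := hC.rank_pair
  refine ⟨⟨?_, ?_⟩, ⟨?_, ?_, ?_⟩, ⟨?_, ?_, ?_⟩, ⟨?_, ?_, ?_⟩, ?_, ?_, ?_⟩ <;>
    exact hp _ (by simp) _ (by simp) (by tauto)

theorem rank_points (hC : IsDesarguesConfiguration f O a₁ a₂ a₃ b₁ b₂ b₃ x₁ x₂) :
    f {O} = 1 ∧ (f {a₁} = 1 ∧ f {a₂} = 1 ∧ f {a₃} = 1) ∧
      (f {b₁} = 1 ∧ f {b₂} = 1 ∧ f {b₃} = 1) := by
  have hp := hC.rank_point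
  refine ⟨?_, ⟨?_, ?_, ?_⟩, ?_, ?_, ?_⟩ <;> exact hp _ (by simp)

theorem three_le_O_a₁_a₂ (hf : IsPolymatroid f)
    (hC : IsDesarguesConfiguration f O a₁ a₂ a₃ b₁ b₂ b₃ x₁ x₂) : 3 ≤ f {O, a₁, a₂} := by
  have h1 := hf.insert_le a₃ {O, a₁, a₂}
  have h2 := hf.mono {O, a₁, a₂, a₃} (insert a₃ {O, a₁, a₂}) (by simp [Set.insert_subset_iff])
  linarith [hC.rank_four, hC.rank_points.2.1.2.2]

theorem three_le_a₁_b₁_b₂ (hf : IsPolymatroid f)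
    (hC : IsDesarguesConfiguration f O a₁ a₂ a₃ b₁ b₂ b₃ x₁ x₂) : 3 ≤ f {a₁, b₁, b₂} := by
  obtain ⟨-, ⟨-, hOb₂, -⟩, -, -, hab, -, -⟩ := hC.rank_pairs
  have h1 := hf.union_line_le (S := {a₁, b₁, b₂}) hC.perspective₁.le hab.ge
    (by simp) (by simp) (by simp) (by simp)
  have h2 := hf.union_line_le (S := {a₁, b₁, b₂} ∪ {O, a₁, b₁}) hC.perspective₂.le hOb₂.ge
    (by simp) (by simp) (by simp) (by simp)
  have h3 := hf.mono {O, a₁, a₂} ({a₁, b₁, b₂} ∪ {O, a₁, b₁} ∪ {O, a₂, b₂})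
    (by simp [Set.insert_subset_iff])
  linarith [hC.three_le_O_a₁_a₂ hf]

theorem three_le_b₁_a₁_a₂ (hf : IsPolymatroid f)
    (hC : IsDesarguesConfiguration f O a₁ a₂ a₃ b₁ b₂ b₃ x₁ x₂) : 3 ≤ f {b₁, a₁, a₂} := by
  obtain ⟨-, -, -, -, hab, -, -⟩ := hC.rank_pairs
  have h1 := hf.union_line_le (S := {b₁, a₁, a₂}) hC.perspective₁.le hab.ge
    (by simp) (by simp) (by simp) (by simp)
  have h2 := hf.mono {O, a₁, a₂} ({b₁, a₁, a₂} ∪ {O, a₁, b₁}) (by simp [Set.insert_subset_iff])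
  linarith [hC.three_le_O_a₁_a₂ hf]

/-- The lines `a₁a₂` and `b₁b₂` lie in a plane. -/
theorem plane_union_le (hf : IsPolymatroid f)
    (hC : IsDesarguesConfiguration f O a₁ a₂ a₃ b₁ b₂ b₃ x₁ x₂) :
    f ({O, a₁, a₂} ∪ {O, a₁, b₁} ∪ {O, a₂, b₂}) ≤ 3 := by
  obtain ⟨⟨hO₁, hO₂⟩, -, ⟨h12, -, -⟩, -⟩ := hC.rank_pairs
  have h0 := hf.insert_le O {a₁, a₂}
  have h1 := hf.union_line_le (S := {O, a₁, a₂}) hC.perspective₁.le hO₁.ge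
    (by simp) (by simp) (by simp) (by simp)
  have h2 := hf.union_line_le (S := {O, a₁, a₂} ∪ {O, a₁, b₁}) hC.perspective₂.le hO₂.ge
    (by simp) (by simp) (by simp) (by simp)
  linarith [hC.rank_points.1]

/-- The planes of the two triangles meet in a line, which contains `x₁`, `x₂` and every common
point `z` of the lines `a₁a₂` and `b₁b₂`. -/
theorem collinear (hf : IsPolymatroid f)
    (hC : IsDesarguesConfiguration f O a₁ a₂ a₃ b₁ b₂ b₃ x₁ x₂) {z : E}
    (ha : f {a₁, a₂, z} ≤ 2) (hb : f {b₁, b₂, z} ≤ 2) : f {x₁, x₂, z} = 2 := by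
  obtain ⟨-, -, ⟨a12, a13, a23⟩, ⟨b12, b13, b23⟩, hab, -, hx⟩ := hC.rank_pairs
  obtain ⟨-, ⟨ha₁, -, -⟩, hb₁, -, -⟩ := hC.rank_points
  have hA := hf.triangle_le ha₁ a12 a13 a23 hC.a_x₁.le hC.a_x₂.le ha
  have hB := hf.triangle_le hb₁ b12 b13 b23 hC.b_x₁.le hC.b_x₂.le hb
  set A : Set E := {a₁, a₂, a₃} ∪ {a₂, a₃, x₁} ∪ {a₁, a₃, x₂} ∪ {a₁, a₂, z} with hAdef
  set B : Set E := {b₁, b₂, b₃} ∪ {b₂, b₃, x₁} ∪ {b₁, b₃, x₂} ∪ {b₁, b₂, z} with hBdef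
  have h1 := hf.union_line_le (S := A ∪ B) hC.perspective₁.le hab.ge
    (by simp [hAdef]) (by simp [hBdef]) (by simp) (by simp)
  have h2 := hf.mono {O, a₁, a₂, a₃} (A ∪ B ∪ {O, a₁, b₁})
    (by simp [hAdef, Set.insert_subset_iff])
  have h3 := hf.le_of_subset_inter (Q := {x₁, x₂, z}) (R := A ∪ B)
    (by simp [hAdef, hBdef, Set.insert_subset_iff]) le_rfl
  have h4 := hf.mono {x₁, x₂} {x₁, x₂, z} (by simp [Set.insert_subset_iff])
  linarith [hC.rank_four]

/-- Any two common points of the lines `a₁a₂` and `b₁b₂` are parallel. -/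
theorem parallel (hf : IsPolymatroid f)
    (hC : IsDesarguesConfiguration f O a₁ a₂ a₃ b₁ b₂ b₃ x₁ x₂) {y z : E}
    (hay : f {a₁, a₂, y} ≤ 2) (hby : f {b₁, b₂, y} ≤ 2)
    (haz : f {a₁, a₂, z} ≤ 2) (hbz : f {b₁, b₂, z} ≤ 2) : f {z, y} ≤ 1 := by
  obtain ⟨-, -, ⟨a12, -, -⟩, ⟨b12, -, -⟩, -⟩ := hC.rank_pairs
  have hA := hf.union_line_le (S := {a₁, a₂, z}) hay a12.ge (by simp) (by simp) (by simp) (by simp)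
  have hB := hf.union_line_le (S := {b₁, b₂, z}) hby b12.ge (by simp) (by simp) (by simp) (by simp)
  have h := hf.le_of_subset_inter (Q := {z, y}) (R := {a₁, b₁, b₂})
    (S := {a₁, a₂, z} ∪ {a₁, a₂, y}) (T := {b₁, b₂, z} ∪ {b₁, b₂, y})
    (by simp [Set.insert_subset_iff]) (by simp [Set.insert_subset_iff])
  linarith [hC.three_le_a₁_b₁_b₂ hf]

/-- The line `x₁x₂` together with the plane of the lines `a₁a₂` and `b₁b₂` has rank four, so it
meets this plane in rank one. -/
theorem rank_union_eq_four (hf : IsPolymatroid f)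
    (hC : IsDesarguesConfiguration f O a₁ a₂ a₃ b₁ b₂ b₃ x₁ x₂) :
    f ({a₁, a₂, b₁, b₂} ∪ {x₁, x₂}) = 4 := by
  obtain ⟨⟨hO₁, hO₂⟩, -, ⟨a12, a13, a23⟩, -, hab, hax, -⟩ := hC.rank_pairs
  apply le_antisymm
  · have h1 := hf.union_line_le (S := {O, a₁, a₂, a₃}) hC.perspective₁.le hO₁.ge
      (by simp) (by simp) (by simp) (by simp)
    have h2 := hf.union_line_le (S := {O, a₁, a₂, a₃} ∪ {O, a₁, b₁}) hC.perspective₂.le hO₂.ge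
      (by simp) (by simp) (by simp) (by simp)
    have h3 := hf.union_line_le (S := {O, a₁, a₂, a₃} ∪ {O, a₁, b₁} ∪ {O, a₂, b₂}) hC.a_x₁.le
      a23.ge (by simp) (by simp) (by simp) (by simp)
    have h4 := hf.union_line_le
      (S := {O, a₁, a₂, a₃} ∪ {O, a₁, b₁} ∪ {O, a₂, b₂} ∪ {a₂, a₃, x₁}) hC.a_x₂.le
      a13.ge (by simp) (by simp) (by simp) (by simp)
    have h5 := hf.mono ({a₁, a₂, b₁, b₂} ∪ {x₁, x₂})
      ({O, a₁, a₂, a₃} ∪ {O, a₁, b₁} ∪ {O, a₂, b₂} ∪ {a₂, a₃, x₁} ∪ {a₁, a₃, x₂})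
      (by simp [Set.insert_subset_iff])
    linarith [hC.rank_four]
  · have h1 := hf.union_line_le (S := {a₁, a₂, b₁, b₂} ∪ {x₁, x₂}) hC.perspective₁.le hab.ge
      (by simp) (by simp) (by simp) (by simp)
    have h2 := hf.union_line_le (S := {a₁, a₂, b₁, b₂} ∪ {x₁, x₂} ∪ {O, a₁, b₁}) hC.a_x₂.le
      hax.ge (by simp) (by simp) (by simp) (by simp)
    have h3 := hf.mono {O, a₁, a₂, a₃}
      ({a₁, a₂, b₁, b₂} ∪ {x₁, x₂} ∪ {O, a₁, b₁} ∪ {a₁, a₃, x₂}) (by simp [Set.insert_subset_iff])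
    linarith [hC.rank_four]

end IsDesarguesConfiguration

theorem mainTheorem2 {E : Type u} (f : Set E → ℝ) (hf : IsAlmostEntropic f)
    (O a₁ a₂ a₃ b₁ b₂ b₃ x₁ x₂ : E)
    (hC : IsDesarguesConfiguration f O a₁ a₂ a₃ b₁ b₂ b₃ x₁ x₂) :
    ∃ (E' : Type u) (ι : E ↪ E') (f' : Set E' → ℝ) (x₃ : E'),
      IsAlmostEntropic f' ∧
      (∀ S : Set E, f' (ι '' S) = f S) ∧
      f' {x₃} = 1 ∧
      f' {ι a₁, ι a₂, x₃} = 2 ∧ f' {ι b₁, ι b₂, x₃} = 2 ∧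
      f' {ι a₁, x₃} = 2 ∧ f' {ι b₁, x₃} = 2 ∧
      f' {ι x₁, ι x₂, x₃} = 2 ∧
      ∀ y : E, f {a₁, a₂, y} = 2 → f {b₁, b₂, y} = 2 → f {y} = 1 →
        f {y, a₁} = 2 → f {y, b₁} = 2 →
          f' {x₃, ι y} = 1 ∧ f {x₁, x₂, y} = 2 := by
  have hfp := hf.polymatroid
  obtain ⟨g, hg, hAK, hgf⟩ := hf.exists_isAhlswedeKorner (A := {a₁, a₂, b₁, b₂}) (B := {x₁, x₂})
    (Set.toFinite _) (Set.toFinite _)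
  have hgp := hg.polymatroid
  have hCg := hC.map (E' := Option E) (g := g) Function.Embedding.some hgf
  simp only [Function.Embedding.some_apply] at hCg
  obtain ⟨-, -, ⟨a12, a13, a23⟩, ⟨b12, b13, b23⟩, -, -, hx⟩ := hC.rank_pairs
  obtain ⟨-, -, ⟨a12', -, -⟩, ⟨b12', -, -⟩, -⟩ := hCg.rank_pairs
  obtain ⟨-, ⟨ha₁, -, -⟩, hb₁, -, -⟩ := hC.rank_points
  obtain ⟨-, ⟨ha₁', -, -⟩, hb₁', -, -⟩ := hCg.rank_points
  have hA3 : f {a₁, a₂, b₁, b₂} ≤ 3 :=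
    (hfp.mono _ _ (by simp [Set.insert_subset_iff])).trans (hC.plane_union_le hfp)
  have hA3' : 3 ≤ f {a₁, a₂, b₁, b₂} :=
    (hC.three_le_a₁_b₁_b₂ hfp).trans (hfp.mono _ _ (by simp [Set.insert_subset_iff]))
  have hAB := hC.rank_union_eq_four hfp
  have hax : f ({a₁, a₂} ∪ {x₁, x₂}) ≤ 3 :=
    (hfp.mono _ _ (by simp [Set.insert_subset_iff])).trans
      (hfp.triangle_le (z := a₁) ha₁ a12 a13 a23 hC.a_x₁.le hC.a_x₂.le
        ((hfp.mono _ {a₁, a₂} (by simp [Set.insert_subset_iff])).trans a12.le))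
  have hbx : f ({b₁, b₂} ∪ {x₁, x₂}) ≤ 3 :=
    (hfp.mono _ _ (by simp [Set.insert_subset_iff])).trans
      (hfp.triangle_le (z := b₁) hb₁ b12 b13 b23 hC.b_x₁.le hC.b_x₂.le
        ((hfp.mono _ {b₁, b₂} (by simp [Set.insert_subset_iff])).trans b12.le))
  -- the mutual information of the plane and the line is `3 + 2 - 4`
  have hw1 : g {none} ≤ 1 := by
    have := hAK.rank_le
    rw [hgf, hgf, hgf] at this
    linarith
  -- the line reduces the rank of the plane from `3` to `4 - 2`, and `none` at least as much
  have hw2 : 1 ≤ g {none} := by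
    have h1 := hAK.conditional _ le_rfl
    have h2 := hgp.mono _ _ (Set.subset_insert none (some '' {a₁, a₂, b₁, b₂}))
    rw [hgf] at h1 h2
    rw [hgf] at h1
    linarith
  have hline : ∀ p q : E, ({p, q} : Set E) ⊆ {a₁, a₂, b₁, b₂} → f ({p, q} ∪ {x₁, x₂}) ≤ 3 →
      g {some p, some q, none} ≤ 2 := by
    intro p q hpq hpq3
    have h1 := hAK.conditional {p, q} hpq
    rw [hgf, hgf] at h1
    have h2 := hgp.mono {some p, some q, none} (insert none (some '' {p, q}))
      (by simp [Set.insert_subset_iff])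
    linarith
  have hwa := hline a₁ a₂ (by simp [Set.insert_subset_iff]) hax
  have hwb := hline b₁ b₂ (by simp [Set.insert_subset_iff]) hbx
  refine ⟨Option E, Function.Embedding.some, g, none, hg, hgf, le_antisymm hw1 hw2,
    ?_, ?_, ?_, ?_, ?_, fun y hay hby hy _ _ => ⟨?_, hC.collinear hfp hay.le hby.le⟩⟩ <;>
    simp only [Function.Embedding.some_apply]
  · exact le_antisymm hwa (a12'.ge.trans (hgp.mono _ _ (by simp [Set.insert_subset_iff])))
  · exact le_antisymm hwb (b12'.ge.trans (hgp.mono _ _ (by simp [Set.insert_subset_iff])))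
  · refine le_antisymm (by linarith [hgp.insert_le (some a₁) {none}]) ?_
    have := hgp.le_of_subset_inter (Q := {none}) (R := {some a₁, some b₁, some b₂})
      (S := {some a₁, none}) (T := {some b₁, some b₂, none})
      (by simp) (by simp [Set.insert_subset_iff])
    linarith [hCg.three_le_a₁_b₁_b₂ hgp]
  · refine le_antisymm (by linarith [hgp.insert_le (some b₁) {none}]) ?_
    have := hgp.le_of_subset_inter (Q := {none}) (R := {some b₁, some a₁, some a₂})
      (S := {some b₁, none}) (T := {some a₁, some a₂, none})
      (by simp) (by simp [Set.insert_subset_iff])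
    linarith [hCg.three_le_b₁_a₁_a₂ hgp]
  · exact hCg.collinear hgp hwa hwb
  · have h3 : ∀ p q r : E, g {some p, some q, some r} = f {p, q, r} := fun p q r => by
      rw [← hgf, Set.image_insert_eq, Set.image_pair]
    refine le_antisymm (hCg.parallel hgp ?_ ?_ hwa hwb)
      (hw2.trans (hgp.mono _ _ (by simp)))
    · rw [h3, hay]
    · rw [h3, hby]
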